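/- Let $d\ge1$. For a field $K$, write $\varphi_{\mathbf a,\mathbf b}(z)=\dfrac{a_0z^d+a_1z^{d-1}+\cdots+a_d}{b_0z^d+b_1z^{d-1}+\cdots+b_d}\in K(z)$ for $\mathbf a,\mathbf b\in K^{d+1}$ with $\mathbf b\neq\mathbf 0$, and $[\mathbf a,\mathbf b]$ for the point of $\mathbb P^{2d+1}(K)$ with homogeneous coordinates $a_0,\dots,a_d,b_0,\dots,b_d$. For $m\ge1$ with $m\ne0$ in $K$, the $(m,0)$-Landen transform of $\varphi\in K(z)$ is the rational function $\mathfrak F_{m,0}(\varphi)\in K(z)$ characterized by $$\mathfrak F_{m,0}(\varphi)(w^m)=\frac1m\sum_{t=0}^{m-1}\varphi(\zeta_m^tw),$$ where $\zeta_m$ is a primitive $m$-th root of unity in an algebraic closure of $K$. For each $m\ge1$ there is a unique rational map $\mathfrak R_{d,m,0}:\mathbb P^{2d+1}_{\mathbb Z}\dashrightarrow\mathbb P^{2d+1}_{\mathbb Z}$ such that for every field $K$ in which $m\neq0$ and all $\varphi_{\mathbf a,\mathbf b}\in K(z)$ of degree $d$ whose transform $\mathfrak F_{m,0}(\varphi_{\mathbf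 a,\mathbf b})=\varphi_{\mathbf a',\mathbf b'}$ also has degree $d$, the map $\mathfrak R_{d,m,0}$ is defined at $[\mathbf a,\mathbf b]$ and sends it to $[\mathbf a',\mathbf b']$. These maps have the following properties, where a rational self-map of a scheme over $\mathbb Z$ is called dominant if it is dominant and, moreover, restricts to a dominant rational self-map of the fibre over every point of $\operatorname{Spec}\mathbb Z$ (that is, over $\mathbb Q$ and over $\mathbb F_p$ for every prime $p$). (1) Each $\mathfrak R_{d,m,0}$ is dominant and has algebraic degree $m$, i.e. it is given by homogeneous polynomials of degree $m$ in $\mathbb Z[\mathbf a,\mathbf b]$ without a nontrivial common factor; and $\mathfrak R_{d,m,0}\circ\mathfrak R_{d,n,0}=\mathfrak R_{d,n,0}\circ\mathfrak R_{d,m,0}$ for all $m,n\ge1$. (2) The open subscheme $\{b_0\neq0\}\subset\mathbb P^{2d+1}_{\mathbb Z}$ is isomorphic to $\mathbb A^{2d+1}_{\mathbb Z}$ through $(a_0,\dots,a_d,b_1,\dots,b_d)\mapsto[a_0,\dots,a_d,1,b_1,\dots,b_d]$. Each $\mathfrak R_{d,m,0}$ is defined along it and restricts to a dominant polynomial endomorphism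 of it, and these endomorphisms, for $m\ge1$, commute with each other. (3) The locally closed subscheme $\{a_0=0,\ b_0\neq0\}\subset\mathbb P^{2d+1}_{\mathbb Z}$ is isomorphic to $\mathbb A^{2d}_{\mathbb Z}$ through $(a_1,\dots,a_d,b_1,\dots,b_d)\mapsto[0,a_1,\dots,a_d,1,b_1,\dots,b_d]$. Each $\mathfrak R_{d,m,0}$ restricts to a dominant polynomial endomorphism of it, and these endomorphisms, for $m\ge1$, commute with each other. -/

import Mathlib

open CategoryTheory AlgebraicGeometry

namespace Landen

/-! ### Rational functions and the Landen transform -/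

section Transform

variable {K : Type} [Field K]

/-- The polynomial `a₀ z ^ d + a₁ z ^ (d - 1) + ⋯ + a_d` with coefficient vector `a`. -/
noncomputable def form {d : ℕ} (a : Fin (d + 1) → K) : Polynomial K :=
  ∑ i : Fin (d + 1), Polynomial.C (a i) * Polynomial.X ^ (d - (i : ℕ))

/-- The rational function `(a₀ z ^ d + ⋯ + a_d) / (b₀ z ^ d + ⋯ + b_d)`. -/
noncomputable def ratFun {d : ℕ} (a b : Fin (d + 1) → K) : RatFunc K :=
  algebraMap (Polynomial K) (RatFunc K) (form a) / algebraMap (Polynomial K) (RatFunc K) (form b)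

/-- The degree of a rational function: the larger of the degrees of its numerator and denominator
in lowest terms. -/
noncomputable def ratDegree (φ : RatFunc K) : ℕ :=
  max φ.num.natDegree φ.denom.natDegree

/-- `ψ` is the `(m, k)`-Landen transform of `φ`: for a primitive `m`-th root of unity `ζ` in an
algebraic closure `L` of `K`, the identity
`ψ (w ^ m) = 1 / (m w ^ k) * ∑ t < m, ζ ^ (-k t) φ (ζ ^ t w)` holds in the field `L(w)`. -/
def IsLandenTransform (m k : ℕ) (φ ψ : RatFunc K) : Prop :=
  ∃ ζ : AlgebraicClosure K, IsPrimitiveRoot ζ m ∧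
    ψ.eval (RatFunc.C.comp (algebraMap K (AlgebraicClosure K))) (RatFunc.X ^ m) =
      1 / ((m : RatFunc (AlgebraicClosure K)) * RatFunc.X ^ k) *
        ∑ t ∈ Finset.range m, RatFunc.C ((ζ ^ (k * t))⁻¹) *
          φ.eval (RatFunc.C.comp (algebraMap K (AlgebraicClosure K)))
            (RatFunc.C (ζ ^ t) * RatFunc.X)

end Transform

/-! ### Projective space over `ℤ` -/

section Projective

attribute [local instance] MvPolynomial.gradedAlgebra

/-- Projective space over `ℤ` with homogeneous coordinates indexed by `σ`. -/
noncomputable def ProjSpace (σ : Type) : Scheme.{0} :=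
  Proj (MvPolynomial.homogeneousSubmodule σ ℤ)

variable {σ : Type}

/-- The standard open subscheme on which the `i`-th homogeneous coordinate does not vanish. -/
noncomputable def coordOpen (i : σ) : (ProjSpace σ).Opens :=
  Proj.basicOpen (MvPolynomial.homogeneousSubmodule σ ℤ) (MvPolynomial.X i)

/-- Evaluation of the homogeneous coordinates at a vector of elements of `A`. -/
noncomputable def coordHom (A : Type) [CommRing A] (v : σ → A) :
    MvPolynomial σ ℤ →+* Γ(Spec (.of A), ⊤) :=
  (Scheme.ΓSpecIso (.of A)).inv.hom.comp (MvPolynomial.aeval v).toRingHom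

lemma map_irrelevant_eq_top (A : Type) [CommRing A] (v : σ → A)
    (hv : Ideal.span (Set.range v) = ⊤) :
    (HomogeneousIdeal.irrelevant (MvPolynomial.homogeneousSubmodule σ ℤ)).toIdeal.map
      (coordHom A v) = ⊤ := by
  have h : Ideal.span (Set.range v) ≤
      (HomogeneousIdeal.irrelevant (MvPolynomial.homogeneousSubmodule σ ℤ)).toIdeal.map
        (MvPolynomial.aeval (R := ℤ) v).toRingHom := by
    rw [Ideal.span_le]
    rintro _ ⟨i, rfl⟩
    have hi : (MvPolynomial.X i : MvPolynomial σ ℤ) ∈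
        (HomogeneousIdeal.irrelevant (MvPolynomial.homogeneousSubmodule σ ℤ)).toIdeal :=
      HomogeneousIdeal.mem_irrelevant_of_mem _ zero_lt_one (MvPolynomial.isHomogeneous_X ℤ i)
    simpa using Ideal.mem_map_of_mem (MvPolynomial.aeval (R := ℤ) v).toRingHom hi
  rw [hv, top_le_iff] at h
  rw [coordHom, ← Ideal.map_map, h, Ideal.map_top]

/-- The `A`-valued point of projective space with homogeneous coordinates `v`, where the entries
of `v` generate the unit ideal of `A`. -/
noncomputable def point {A : Type} [CommRing A] (v : σ → A)
    (hv : Ideal.span (Set.range v) = ⊤) : Spec (.of A) ⟶ ProjSpace σ :=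
  Proj.fromOfGlobalSections (MvPolynomial.homogeneousSubmodule σ ℤ) (coordHom A v)
    (map_irrelevant_eq_top A v hv)

/-- The generic point of projective space. -/
noncomputable def genPoint [Nonempty σ] : ProjSpace σ :=
  (⟨⊥, by
    rw [HomogeneousIdeal.toIdeal_bot]
    exact Ideal.isPrime_bot, fun h => by
    have hi : (MvPolynomial.X (Classical.arbitrary σ) : MvPolynomial σ ℤ) ∈
        HomogeneousIdeal.irrelevant (MvPolynomial.homogeneousSubmodule σ ℤ) :=
      HomogeneousIdeal.mem_irrelevant_of_mem _ zero_lt_one (MvPolynomial.isHomogeneous_X ℤ _)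
    have h0 : (MvPolynomial.X (Classical.arbitrary σ) : MvPolynomial σ ℤ) ∈
        (⊥ : HomogeneousIdeal (MvPolynomial.homogeneousSubmodule σ ℤ)).toIdeal := h hi
    rw [HomogeneousIdeal.toIdeal_bot] at h0
    exact MvPolynomial.X_ne_zero _ (Ideal.mem_bot.mp h0)⟩ :
    ProjectiveSpectrum (MvPolynomial.homogeneousSubmodule σ ℤ))

instance [Nonempty σ] : IrreducibleSpace (ProjSpace σ) := by
  have h : closure ({genPoint} : Set (ProjSpace σ)) = Set.univ := by
    refine Set.eq_univ_of_forall fun y => ?_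
    exact (ProjectiveSpectrum.le_iff_mem_closure
      (𝒜 := MvPolynomial.homogeneousSubmodule σ ℤ) genPoint y).mp
        (show (⊥ : HomogeneousIdeal (MvPolynomial.homogeneousSubmodule σ ℤ)) ≤ _ from bot_le)
  have : PreirreducibleSpace (ProjSpace σ) := ⟨h ▸ isIrreducible_singleton.closure.2⟩
  exact { toNonempty := ⟨genPoint⟩ }

end Projective

/-! ### Rational maps -/

section Rational

/-- The rational map `f` is defined along the `T`-valued point `x` and maps it to `y`. -/
def Sends {X Y T : Scheme.{0}} (f : X ⤏ Y) (x : T ⟶ X) (y : T ⟶ Y) : Prop :=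
  ∃ g : X.PartialMap Y, g.toRationalMap = f ∧
    ∃ x' : T ⟶ g.domain.toScheme, x' ≫ g.domain.ι = x ∧ x' ≫ g.hom = y

/-- The fibre of `X` over the point `s` of `Spec ℤ`. -/
def fibre (X : Scheme.{0}) (s : Spec (.of ℤ)) : Set X :=
  {x | (specZIsTerminal.from X) x = s}

/-- The rational self-map `f` is defined on an open set whose intersection with each fibre over
`Spec ℤ` (so over `ℚ` and over every `𝔽_p`) has dense image in that fibre. -/
def DominantOnFibres {X : Scheme.{0}} (f : X ⤏ X) : Prop :=
  ∃ g : X.PartialMap X, g.toRationalMap = f ∧ ∀ s : Spec (.of ℤ),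
    fibre X s ⊆ closure (g.hom '' (g.domain.ι ⁻¹' fibre X s))

/-- Two dominant rational self-maps that commute. -/
def RatCommute {X : Scheme.{0}} [IrreducibleSpace X] (f g : X ⤏ X) : Prop :=
  ∃ (_ : f.IsDominant) (_ : g.IsDominant), f.comp g = g.comp f

/-- The rational self-map `f` of projective space has algebraic degree `m`: it is given by
homogeneous polynomials of degree `m` over `ℤ` without a nontrivial common factor. -/
def HasAlgebraicDegree {σ : Type} (f : ProjSpace σ ⤏ ProjSpace σ) (m : ℕ) : Prop :=
  ∃ F : σ → MvPolynomial σ ℤ, (∀ i, (F i).IsHomogeneous m) ∧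
    (∀ u : MvPolynomial σ ℤ, (∀ i, u ∣ F i) → IsUnit u) ∧
    ∀ (K : Type) [Field K] (v : σ → K) (hv : Ideal.span (Set.range v) = ⊤)
      (hF : Ideal.span (Set.range fun i => MvPolynomial.aeval v (F i)) = ⊤),
      Sends f (point v hv) (point (fun i => MvPolynomial.aeval v (F i)) hF)

/-- Projective `(2 d + 1)`-space over `ℤ`, with homogeneous coordinates `a₀, …, a_d` (indices
`Sum.inl i`) and `b₀, …, b_d` (indices `Sum.inr i`). -/
noncomputable abbrev PP (d : ℕ) : Scheme.{0} := ProjSpace (Fin (d + 1) ⊕ Fin (d + 1))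

/-- `f` is the rational self-map of projective `(2 d + 1)`-space induced by the `(m, k)`-Landen
transform: over every field `K` in which `m ≠ 0`, if `φ = ratFun a b` has degree `d` and its
transform has degree `d` too and so is of the form `ratFun a' b'`, then `f` is defined at `[a, b]`
and maps it to `[a', b']`. -/
def IsLandenMap (d m k : ℕ) (f : PP d ⤏ PP d) : Prop :=
  ∀ (K : Type) [Field K], (m : K) ≠ 0 → ∀ a b a' b' : Fin (d + 1) → K,
    ratDegree (ratFun a b) = d → IsLandenTransform m k (ratFun a b) (ratFun a' b') →
    ratDegree (ratFun a' b') = d →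
    ∀ (h : Ideal.span (Set.range (Sum.elim a b)) = ⊤)
      (h' : Ideal.span (Set.range (Sum.elim a' b')) = ⊤),
      Sends f (point (Sum.elim a b) h) (point (Sum.elim a' b') h')

end Rational

/-! ### Affine charts -/

section Affine

/-- Affine space over `ℤ` with coordinates indexed by `τ`. -/
noncomputable abbrev Aff (τ : Type) : Scheme.{0} := Spec (.of (MvPolynomial τ ℤ))

/-- The polynomial endomorphism of affine space with the given coordinate polynomials. -/
noncomputable def polyMap {τ : Type} (e : τ → MvPolynomial τ ℤ) : Aff τ ⟶ Aff τ :=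
  Spec.map (CommRingCat.ofHom (MvPolynomial.aeval e).toRingHom)

lemma span_eq_top_of_one {σ A : Type} [CommRing A] (v : σ → A) (i : σ) (h : v i = 1) :
    Ideal.span (Set.range v) = ⊤ :=
  (Ideal.eq_top_iff_one _).mpr (h ▸ Ideal.subset_span ⟨i, rfl⟩)

/-- The morphism `(a₀, …, a_d, b₁, …, b_d) ↦ [a₀, …, a_d, 1, b₁, …, b_d]` from affine
`(2 d + 1)`-space. -/
noncomputable def chart (d : ℕ) : Aff (Fin (d + 1) ⊕ Fin d) ⟶ PP d :=
  point (Sum.elim (fun i => MvPolynomial.X (Sum.inl i))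
      (Fin.cons 1 fun i => MvPolynomial.X (Sum.inr i)))
    (span_eq_top_of_one _ (Sum.inr 0) rfl)

/-- The morphism `(a₁, …, a_d, b₁, …, b_d) ↦ [0, a₁, …, a_d, 1, b₁, …, b_d]` from affine
`2 d`-space. -/
noncomputable def slice (d : ℕ) : Aff (Fin d ⊕ Fin d) ⟶ PP d :=
  point (Sum.elim (Fin.cons 0 fun i => MvPolynomial.X (Sum.inl i))
      (Fin.cons 1 fun i => MvPolynomial.X (Sum.inr i)))
    (span_eq_top_of_one _ (Sum.inr 0) rfl)

end Affine

end Landen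

/-! In the variable `u = 1 / z` a rational function becomes `p / q` with `p = ∑ a_i u ^ i` and `q =
∑ b_i u ^ i`. The rotates of `q` by the `m`-th roots of unity have a product `q * c`, which is a
polynomial in `u ^ m` and a common denominator for the average. Averaging `p * c` keeps the
coefficients whose exponent is divisible by `m`. Hence the transform has numerator `contract m (p *
c)` and denominator `contract m (q * c)` (`landenNum`, `sum_div_root_of_unity`). Writing `c` as the
resultant of `1 + Y + ⋯ + Y ^ (m - 1)` and `q (u Y)` (`cofactor`) gives integral forms of degree `m`
that make sense in every characteristic, including those dividing `m`.

If `b₀ = 1` and `q = ∏ (1 - α_i u)`, then `q * c = ∏ (1 - α_i ^ m u ^ m)` (`prod_mul_cofactor`): the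
map raises the reciprocal roots of the denominator to the `m`-th power, and on partial fractions it
sends `1 / (1 - α_i u)` to `1 / (1 - α_i ^ m u)` (`landenNum_prod_erase`). Composing the maps for
`m` and `n` therefore gives the map for `n * m`, so they commute (`aeval_landenForm_comp`). Over an
algebraically closed field of any characteristic, every target with distinct nonzero reciprocal
roots is reached by extracting `m`-th roots and keeping the partial fraction coefficients
(`exists_aeval_landenForm_eq`). This makes the coordinate polynomials algebraically independent
modulo every prime of `ℤ`, which is dominance on every fibre.

The leading coordinates become `a₀ * b₀ ^ (m - 1)` and `b₀ ^ m`, so both affine loci are preserved.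
A common factor of the forms divides `b₀ ^ m`, but `b₀` does not divide the form for `b_d`
(`aeval_landenForm_last`).

Uniqueness is tested at one generic point over a field. Numerator and denominator are coprime there,
and also at its image, whose coordinates are again algebraically independent; so both degrees are
`d`. Rational maps that agree along a dominant morphism coincide (`eq_of_sends`). -/

namespace Landen

/-! ### Points of projective space as evaluation homomorphisms -/

section FunctorOfPoints

attribute [local instance] MvPolynomial.gradedAlgebra

variable {σ : Type} {A : Type} [CommRing A]

/-- The ring of functions on the standard open subscheme `D₊(f)` of projective space. -/
abbrev AwayRing (f : MvPolynomial σ ℤ) : Type :=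
  HomogeneousLocalization.Away (MvPolynomial.homogeneousSubmodule σ ℤ) f

/-- The standard open subscheme of projective space defined by a polynomial. -/
noncomputable def formOpen (f : MvPolynomial σ ℤ) : (ProjSpace σ).Opens :=
  Proj.basicOpen (MvPolynomial.homogeneousSubmodule σ ℤ) f

/-- The standard open subscheme `D₊(f)` is affine. -/
noncomputable def formOpenIso {f : MvPolynomial σ ℤ} {n : ℕ} (hf : f.IsHomogeneous n)
    (hn : 0 < n) : (formOpen f).toScheme ≅ Spec (.of (AwayRing f)) :=
  Proj.basicOpenIsoSpec (MvPolynomial.homogeneousSubmodule σ ℤ) f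
    ((MvPolynomial.mem_homogeneousSubmodule n f).mpr hf) hn

/-- The open immersion of `D₊(f)`, as an affine scheme, into projective space. -/
noncomputable def formι {f : MvPolynomial σ ℤ} {n : ℕ} (hf : f.IsHomogeneous n)
    (hn : 0 < n) : Spec (.of (AwayRing f)) ⟶ ProjSpace σ :=
  Proj.awayι (MvPolynomial.homogeneousSubmodule σ ℤ) f
    ((MvPolynomial.mem_homogeneousSubmodule n f).mpr hf) hn

instance {f : MvPolynomial σ ℤ} {n : ℕ} (hf : f.IsHomogeneous n) (hn : 0 < n) :
    IsOpenImmersion (formι hf hn) :=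
  inferInstanceAs (IsOpenImmersion
    (Proj.awayι (MvPolynomial.homogeneousSubmodule σ ℤ) f
    ((MvPolynomial.mem_homogeneousSubmodule n f).mpr hf) hn))

/-- Evaluation of fractions of degree zero with denominator a power of `f` at a vector where `f`
is invertible. -/
noncomputable def evalAway (v : σ → A) {f : MvPolynomial σ ℤ}
    (hf : IsUnit (MvPolynomial.aeval v f)) : AwayRing f →+* A :=
  (IsLocalization.Away.lift (S := Localization.Away f) f
    (g := (MvPolynomial.aeval (R := ℤ) v).toRingHom) hf).comp
    (algebraMap (AwayRing f) (Localization.Away f))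

lemma evalAway_mk (v : σ → A) {f : MvPolynomial σ ℤ} (hf : IsUnit (MvPolynomial.aeval v f))
    {n : ℕ} (hfn : f ∈ MvPolynomial.homogeneousSubmodule σ ℤ n) (k : ℕ) (x : MvPolynomial σ ℤ)
    (hx : x ∈ MvPolynomial.homogeneousSubmodule σ ℤ (k • n)) :
    evalAway v hf (HomogeneousLocalization.Away.mk _ hfn k x hx) * (MvPolynomial.aeval v f) ^ k =
      MvPolynomial.aeval v x := by
  rw [evalAway, RingHom.comp_apply, HomogeneousLocalization.algebraMap_apply,
    HomogeneousLocalization.Away.val_mk, Localization.mk_eq_mk']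
  have h := congrArg (IsLocalization.Away.lift (S := Localization.Away f) f
    (g := (MvPolynomial.aeval (R := ℤ) v).toRingHom) hf)
    (IsLocalization.mk'_spec (M := .powers f) (Localization.Away f) x ⟨f ^ k, k, rfl⟩)
  rw [map_mul, IsLocalization.Away.lift_eq, IsLocalization.Away.lift_eq] at h
  simpa using h

/-- The hypothesis says that the map of localizations already comes from a map `ψ` into global
sections, so the morphism glued from local data is the restriction of the one induced by `ψ`. -/
lemma toBasicOpenOfGlobalSections_ι {X : Scheme.{0}} (φ : MvPolynomial σ ℤ →+* Γ(X, ⊤))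
    {f : MvPolynomial σ ℤ} {n : ℕ} (hn : 0 < n)
    (hf : f ∈ MvPolynomial.homogeneousSubmodule σ ℤ n) (ψ : AwayRing f →+* Γ(X, ⊤))
    (hψ : (algebraMap Γ(X, ⊤) (Localization.Away (φ f))).comp ψ =
      (IsLocalization.map (M := .powers f) (T := .powers (φ f)) (Localization.Away (φ f)) φ (by
        rw [← Submonoid.map_le_iff_le_comap, Submonoid.map_powers])).comp
          (algebraMap _ (Localization.Away f))) :
    Proj.toBasicOpenOfGlobalSections (MvPolynomial.homogeneousSubmodule σ ℤ) φ rfl hn hf ≫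
        (Proj.basicOpen _ f).ι =
      (X.basicOpen (φ f)).ι ≫ X.toSpecΓ ≫ Spec.map (CommRingCat.ofHom ψ) ≫
        Proj.awayι _ f hf hn := by
  simp only [Proj.toBasicOpenOfGlobalSections, Category.assoc, Proj.basicOpenIsoSpec_inv_ι]
  rw [← hψ, CommRingCat.ofHom_comp, Spec.map_comp, basicOpenIsoSpecAway]
  simp only [Category.assoc]
  rw [IsOpenImmersion.isoOfRangeEq_hom_fac_assoc]
  simp only [← Category.assoc]
  congr 2
  simp only [Category.assoc]
  refine (congrArg _ (morphismRestrict_ι X.toSpecΓ (PrimeSpectrum.basicOpen (φ f)))).trans ?_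
  rw [Scheme.isoOfEq_inv]
  exact Scheme.homOfLE_ι_assoc _ _ _

/-- Where a form has a unit value the point lies in one affine chart. All later computations with
points become computations with `evalAway` through this factorization. -/
lemma point_eq (v : σ → A) (hv : Ideal.span (Set.range v) = ⊤) {f : MvPolynomial σ ℤ}
    (hf : IsUnit (MvPolynomial.aeval v f)) {n : ℕ} (hn : 0 < n) (hfn : f.IsHomogeneous n) :
    point v hv = Spec.map (CommRingCat.ofHom (evalAway v hf)) ≫ formι hfn hn := by
  have hfn' : f ∈ MvPolynomial.homogeneousSubmodule σ ℤ n :=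
    (MvPolynomial.mem_homogeneousSubmodule n f).mpr hfn
  have hu : IsUnit (coordHom A v f) := hf.map (Scheme.ΓSpecIso (.of A)).inv.hom
  have htop : (Spec (.of A)).basicOpen (coordHom A v f) = ⊤ := Scheme.basicOpen_of_isUnit _ hu
  have : IsIso ((Spec (.of A)).basicOpen (coordHom A v f)).ι := by
    rw [htop]; exact inferInstanceAs (IsIso (Scheme.topIso _).hom)
  refine (cancel_epi ((Spec (.of A)).basicOpen (coordHom A v f)).ι).mp ?_
  refine (Scheme.Hom.resLE_comp_ι _
    (Proj.fromOfGlobalSections_preimage_basicOpen (MvPolynomial.homogeneousSubmodule σ ℤ)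
      (coordHom A v) (map_irrelevant_eq_top A v hv) hn hfn').ge).symm.trans ?_
  rw [Proj.fromOfGlobalSections_resLE _ _ _ hn hfn', toBasicOpenOfGlobalSections_ι _ hn hfn'
      ((Scheme.ΓSpecIso (.of A)).inv.hom.comp (evalAway v hf))]
  · congr 1
    rw [← Category.assoc]
    change _ = Spec.map (CommRingCat.ofHom (evalAway v hf)) ≫ Proj.awayι _ f hfn' hn
    congr 1
    rw [CommRingCat.ofHom_comp, Spec.map_comp, ← Category.assoc]
    convert Category.id_comp _
    exact toSpecΓ_SpecMap_ΓSpecIso_inv _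
  · rw [evalAway, ← RingHom.comp_assoc, ← RingHom.comp_assoc]
    congr 1
    refine IsLocalization.ringHom_ext (.powers f) (RingHom.ext fun x => ?_)
    simp only [RingHom.comp_apply, IsLocalization.map_eq]
    rw [IsLocalization.Away.lift_eq]
    rfl


lemma aeval_ringHom_comp {B : Type} [CommRing B] (φ : A →+* B) (v : σ → A)
    (f : MvPolynomial σ ℤ) :
    MvPolynomial.aeval (φ ∘ v) f = φ (MvPolynomial.aeval v f) := by
  have : (MvPolynomial.aeval (R := ℤ) (φ ∘ v)).toRingHom =
      φ.comp (MvPolynomial.aeval (R := ℤ) v).toRingHom :=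
    MvPolynomial.ringHom_ext (fun r => by simp) (fun i => by simp)
  exact RingHom.congr_fun this f

lemma span_range_comp {B : Type} [CommRing B] (φ : A →+* B) (v : σ → A)
    (hv : Ideal.span (Set.range v) = ⊤) : Ideal.span (Set.range (φ ∘ v)) = ⊤ := by
  rw [Set.range_comp, ← Ideal.map_span, hv, Ideal.map_top]

/-- The form with unit value only serves to put both points in the same chart, where base change is
composition of ring homomorphisms. -/
lemma Spec_map_point {B : Type} [CommRing B] (φ : A →+* B) (v : σ → A)
    (hv : Ideal.span (Set.range v) = ⊤) {f : MvPolynomial σ ℤ}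
    (hf : IsUnit (MvPolynomial.aeval v f)) {n : ℕ} (hn : 0 < n) (hfn : f.IsHomogeneous n) :
    Spec.map (CommRingCat.ofHom φ) ≫ point v hv = point (φ ∘ v) (span_range_comp φ v hv) := by
  have hf' : IsUnit (MvPolynomial.aeval (φ ∘ v) f) := by
    rw [aeval_ringHom_comp]
    exact hf.map φ
  rw [point_eq v hv hf hn hfn, point_eq _ _ hf' hn hfn, ← Spec.map_comp_assoc,
    ← CommRingCat.ofHom_comp, evalAway, evalAway, ← RingHom.comp_assoc]
  congr 4
  refine IsLocalization.ringHom_ext (.powers f) (RingHom.ext fun x => ?_)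
  simp only [RingHom.comp_apply]
  rw [IsLocalization.Away.lift_eq, IsLocalization.Away.lift_eq]
  exact (aeval_ringHom_comp φ v x).symm

lemma aeval_smul_of_isHomogeneous {R : Type} [CommRing R] [Algebra R A]
    {f : MvPolynomial σ R} {n : ℕ} (hf : f.IsHomogeneous n) (c : A) (v : σ → A) :
    MvPolynomial.aeval (fun i => c * v i) f = c ^ n * MvPolynomial.aeval v f := by
  rw [MvPolynomial.aeval_def, MvPolynomial.aeval_def, MvPolynomial.eval₂_eq,
    MvPolynomial.eval₂_eq, Finset.mul_sum]
  refine Finset.sum_congr rfl fun d hd => ?_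
  simp only [mul_pow, Finset.prod_mul_distrib, Finset.prod_pow_eq_pow_sum]
  rw [← hf.degree_eq_sum_deg_support hd]
  ring

/-- A form that vanishes after one of the variables is set to `1` is zero. -/
lemma eq_zero_of_aeval_eq_zero {R τ : Type} [CommRing R] [IsDomain R] {i : σ} {j : τ → σ}
    {v : σ → MvPolynomial τ R} (hi : v i = 1) (hj : ∀ t, v (j t) = MvPolynomial.X t)
    (hs : ∀ s, s = i ∨ ∃ t, j t = s) {f : MvPolynomial σ R} {n : ℕ} (hf : f.IsHomogeneous n)
    (h0 : MvPolynomial.aeval v f = 0) : f = 0 := by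
  let K := FractionRing (MvPolynomial σ R)
  let ι := algebraMap (MvPolynomial σ R) K
  have hι : Function.Injective ι := IsFractionRing.injective _ _
  have hX : ι (MvPolynomial.X i) ≠ 0 := by
    rw [Ne, map_eq_zero_iff ι hι]
    exact MvPolynomial.X_ne_zero i
  -- Rehomogenization: `ρ` sends `v s` to `X s / X i` for every `s`, hence the dehomogenized form to
  -- `f / X i ^ n`.
  let ρ : MvPolynomial τ R →ₐ[R] K :=
    MvPolynomial.aeval fun t => (ι (MvPolynomial.X i))⁻¹ * ι (MvPolynomial.X (j t))
  have hρ : ∀ s, ρ (v s) = (ι (MvPolynomial.X i))⁻¹ * ι (MvPolynomial.X s) := by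
    intro s
    rcases hs s with rfl | ⟨t, rfl⟩
    · rw [hi, map_one, inv_mul_cancel₀ hX]
    · rw [hj, MvPolynomial.aeval_X]
  have h1 : ρ (MvPolynomial.aeval v f) = (ι (MvPolynomial.X i))⁻¹ ^ n * ι f := by
    have : ρ (MvPolynomial.aeval v f) = MvPolynomial.aeval (fun s => ρ (v s)) f := by
      rw [← AlgHom.comp_apply, MvPolynomial.comp_aeval]
    rw [this]
    simp only [hρ]
    rw [aeval_smul_of_isHomogeneous hf]
    congr 1
    have : (MvPolynomial.aeval fun s => ι (MvPolynomial.X s)) =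
        IsScalarTower.toAlgHom R (MvPolynomial σ R) K := by
      ext s
      simp [ι]
    rw [this]
    rfl
  rw [h0, map_zero, eq_comm, mul_eq_zero] at h1
  exact (map_eq_zero_iff ι hι).mp (h1.resolve_left (pow_ne_zero _ (inv_ne_zero hX)))

/-- The factor `c` cancels in fractions of degree zero. A unit coordinate of `w` forces `c` to be a
unit and puts both points in one chart. -/
lemma point_smul {v w : σ → A} (c : A) (hvw : ∀ i, w i = c * v i)
    (hv : Ideal.span (Set.range v) = ⊤) (hw : Ideal.span (Set.range w) = ⊤) {i : σ}
    (hi : IsUnit (w i)) : point v hv = point w hw := by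
  have h1 : IsUnit c := isUnit_of_mul_isUnit_left (hvw i ▸ hi)
  have h2 : IsUnit (v i) := isUnit_of_mul_isUnit_right (hvw i ▸ hi)
  have hX := MvPolynomial.isHomogeneous_X ℤ i
  have hi' : IsUnit (MvPolynomial.aeval (R := ℤ) w (MvPolynomial.X i)) := by simpa using hi
  have h2' : IsUnit (MvPolynomial.aeval (R := ℤ) v (MvPolynomial.X i)) := by simpa using h2
  rw [point_eq v hv h2' one_pos hX, point_eq w hw hi' one_pos hX]
  congr 3
  ext x
  obtain ⟨k, y, hy, rfl⟩ := HomogeneousLocalization.Away.mk_surjective _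
    ((MvPolynomial.mem_homogeneousSubmodule 1 _).mpr hX) x
  refine (h2'.pow k).mul_right_cancel ?_
  refine (h1.pow k).mul_left_cancel ?_
  have e1 := evalAway_mk v h2' ((MvPolynomial.mem_homogeneousSubmodule 1 _).mpr hX) k y hy
  have e2 := evalAway_mk w hi' ((MvPolynomial.mem_homogeneousSubmodule 1 _).mpr hX) k y hy
  have e3 : MvPolynomial.aeval w y = c ^ k * MvPolynomial.aeval v y := by
    have hw' : w = fun i => c * v i := funext hvw
    rw [hw', aeval_smul_of_isHomogeneous (n := k) (by simpa using hy)]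
  rw [e1, ← e3, ← e2]
  simp only [MvPolynomial.aeval_X, hvw]
  ring

lemma range_formι {f : MvPolynomial σ ℤ} {n : ℕ} (hf : f.IsHomogeneous n) (hn : 0 < n) :
    Set.range (formι hf hn) = (formOpen f : Set (ProjSpace σ)) :=
  congrArg (fun U : (ProjSpace σ).Opens => (U : Set (ProjSpace σ)))
    (Proj.opensRange_awayι (MvPolynomial.homogeneousSubmodule σ ℤ) f
      ((MvPolynomial.mem_homogeneousSubmodule n f).mpr hf) hn)

lemma point_mem_formOpen (v : σ → A) (hv : Ideal.span (Set.range v) = ⊤)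
    {f : MvPolynomial σ ℤ} {n : ℕ} (hf : f.IsHomogeneous n) (hn : 0 < n) (x : Spec (.of A)) :
    point v hv x ∈ formOpen f ↔ MvPolynomial.aeval v f ∉ x.asIdeal := by
  have h := Proj.fromOfGlobalSections_preimage_basicOpen (MvPolynomial.homogeneousSubmodule σ ℤ)
    (coordHom A v) (map_irrelevant_eq_top A v hv) hn
    ((MvPolynomial.mem_homogeneousSubmodule n f).mpr hf)
  have h2 : point v hv x ∈ formOpen f ↔ x ∈ (Spec (.of A)).basicOpen (coordHom A v f) :=
    SetLike.ext_iff.mp h x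
  rw [h2]
  exact SetLike.ext_iff.mp (basicOpen_eq_of_affine (R := .of A) (MvPolynomial.aeval v f)) x

end FunctorOfPoints

/-! ### Rational maps tested along morphisms -/

section RationalMaps

lemma sends_toRationalMap {X Y S T : Scheme.{0}} {U : X.Opens} (hU : Dense (U : Set X))
    (e : U.toScheme ≅ S) (h : S ⟶ Y) (t : T ⟶ S) :
    Sends (Scheme.PartialMap.mk U hU (e.hom ≫ h)).toRationalMap (t ≫ e.inv ≫ U.ι) (t ≫ h) :=
  ⟨_, rfl, t ≫ e.inv, Category.assoc _ _ _, by
    rw [Category.assoc, Iso.inv_hom_id_assoc]⟩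

lemma range_subset_domain {X Y T : Scheme.{0}} (f : X.PartialMap Y) {x : T ⟶ X}
    {x' : T ⟶ f.domain.toScheme} (hx : x' ≫ f.domain.ι = x) (t : T) : x t ∈ f.domain := by
  rw [← hx, Scheme.Hom.comp_apply]
  exact (x' t).2

/-- Two rational maps that agree along a dominant morphism are equal. -/
lemma eq_of_sends {X Y T : Scheme.{0}} [IrreducibleSpace X] [IsReduced X] [Y.IsSeparated]
    {f g : X ⤏ Y} (x : T ⟶ X) [IsDominant x] {y : T ⟶ Y} (hf : Sends f x y)
    (hg : Sends g x y) : f = g := by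
  obtain ⟨f, rfl, x₁, hx₁, hy₁⟩ := hf
  obtain ⟨g, rfl, x₂, hx₂, hy₂⟩ := hg
  have hd : Dense ((f.domain ⊓ g.domain : X.Opens) : Set X) :=
    f.dense_domain.inter_of_isOpen_left g.dense_domain f.domain.2
  have hr : Set.range x ⊆ Set.range (f.domain ⊓ g.domain).ι := by
    rw [Scheme.Opens.range_ι]
    rintro _ ⟨t, rfl⟩
    exact ⟨range_subset_domain f hx₁ t, range_subset_domain g hx₂ t⟩
  have hw := IsOpenImmersion.lift_fac (f.domain ⊓ g.domain).ι x hr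
  generalize IsOpenImmersion.lift (f.domain ⊓ g.domain).ι x hr = w at hw
  have : IsDominant w := by
    have : IsDominant (w ≫ (f.domain ⊓ g.domain).ι) := by rwa [hw]
    exact IsDominant.of_comp_of_isOpenImmersion w (f.domain ⊓ g.domain).ι
  have e₁ : w ≫ X.homOfLE inf_le_left = x₁ := by
    rw [← cancel_mono f.domain.ι, Category.assoc, Scheme.homOfLE_ι, hw, hx₁]
  have e₂ : w ≫ X.homOfLE inf_le_right = x₂ := by
    rw [← cancel_mono g.domain.ι, Category.assoc, Scheme.homOfLE_ι, hw, hx₂]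
  -- On the common domain the two morphisms agree after the dominant `w`; reducedness of the source
  -- and separatedness of the target make them equal.
  have key : X.homOfLE (inf_le_left : f.domain ⊓ g.domain ≤ f.domain) ≫ f.hom =
      X.homOfLE (inf_le_right : f.domain ⊓ g.domain ≤ g.domain) ≫ g.hom :=
    ext_of_isDominant w (by rw [reassoc_of% e₁, hy₁, reassoc_of% e₂, hy₂])
  exact Scheme.PartialMap.toRationalMap_eq_iff.mpr
    ⟨f.domain ⊓ g.domain, hd, inf_le_left, inf_le_right, key⟩

/-- The images of a morphism under rational maps compose. -/
lemma Sends.comp {X T : Scheme.{0}} [IrreducibleSpace X] {f g : X ⤏ X} [f.IsDominant]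
    {x y z : T ⟶ X} (hf : Sends f x y) (hg : Sends g y z) : Sends (f.comp g) x z := by
  obtain ⟨f, rfl, x₁, hx₁, hy₁⟩ := hf
  obtain ⟨g, rfl, x₂, hx₂, hy₂⟩ := hg
  have : IsDominant f.hom := (f.isDominant_toRationalMap_iff).mp inferInstance
  have hr : Set.range x₁ ⊆ Set.range (f.hom ⁻¹ᵁ g.domain).ι := by
    rw [Scheme.Opens.range_ι]
    rintro _ ⟨t, rfl⟩
    change f.hom (x₁ t) ∈ g.domain
    rw [← Scheme.Hom.comp_apply, hy₁]
    exact range_subset_domain g hx₂ t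
  have hw := IsOpenImmersion.lift_fac (f.hom ⁻¹ᵁ g.domain).ι x₁ hr
  generalize IsOpenImmersion.lift (f.hom ⁻¹ᵁ g.domain).ι x₁ hr = w at hw
  have hw₂ : w ≫ f.hom ∣_ g.domain = x₂ := by
    rw [← cancel_mono g.domain.ι, Category.assoc, morphismRestrict_ι, reassoc_of% hw, hy₁, hx₂]
  refine ⟨f.comp g, (Scheme.RationalMap.toRationalMap_comp f g).symm,
    w ≫ (f.domain.ι.isoImage (f.hom ⁻¹ᵁ g.domain)).hom, ?_, ?_⟩
  · refine (Category.assoc _ _ _).trans ?_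
    refine (congrArg _ (Scheme.Hom.isoImage_hom_ι _ _)).trans ?_
    rw [reassoc_of% hw, hx₁]
  · refine (Category.assoc _ _ _).trans ?_
    refine (congrArg (w ≫ ·) (Iso.hom_inv_id_assoc _ (f.hom ∣_ g.domain ≫ g.hom))).trans ?_
    rw [reassoc_of% hw₂, hy₂]

end RationalMaps

/-! ### Maps between projective spaces given by forms -/

section Charts

attribute [local instance] MvPolynomial.gradedAlgebra

variable {σ : Type} {A : Type} [CommRing A]

/-- The fraction `g / f` of two forms of the same degree. -/
noncomputable def formFrac {f g : MvPolynomial σ ℤ} {n : ℕ} (hf : f.IsHomogeneous n)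
    (hg : g.IsHomogeneous n) : AwayRing f :=
  HomogeneousLocalization.Away.mk (MvPolynomial.homogeneousSubmodule σ ℤ)
    ((MvPolynomial.mem_homogeneousSubmodule n f).mpr hf) 1 g
    (by rwa [one_smul, MvPolynomial.mem_homogeneousSubmodule])

lemma evalAway_formFrac (v : σ → A) {f g : MvPolynomial σ ℤ} {n : ℕ} (hf : f.IsHomogeneous n)
    (hg : g.IsHomogeneous n) (hu : IsUnit (MvPolynomial.aeval v f)) :
    MvPolynomial.aeval v f * evalAway v hu (formFrac hf hg) = MvPolynomial.aeval v g := by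
  have := evalAway_mk v hu ((MvPolynomial.mem_homogeneousSubmodule n f).mpr hf) 1 g
    (by rwa [one_smul, MvPolynomial.mem_homogeneousSubmodule])
  rwa [pow_one, mul_comm] at this

lemma formFrac_self {f : MvPolynomial σ ℤ} {n : ℕ} (hf : f.IsHomogeneous n) :
    formFrac hf hf = 1 := by
  apply HomogeneousLocalization.val_injective
  rw [formFrac, HomogeneousLocalization.Away.val_mk, HomogeneousLocalization.val_one]
  rw [Localization.mk_eq_mk', IsLocalization.mk'_eq_iff_eq_mul, one_mul]
  simp

lemma surjective_of_X_mem_range {τ : Type} (g : A →+* MvPolynomial τ ℤ)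
    (hg : ∀ t, MvPolynomial.X t ∈ Set.range g) : Function.Surjective g := by
  intro y
  change y ∈ g.range
  induction y using MvPolynomial.induction_on with
  | C a => exact ⟨a, by simp⟩
  | add p q hp hq => exact add_mem hp hq
  | mul_X p t hp => exact mul_mem hp (hg t)

/-- A morphism from an affine space to projective space that inverts the substitution of `1` for a
variable is an open immersion. -/
lemma isOpenImmersion_point {τ : Type} {i : σ} {j : τ → σ} {v : σ → MvPolynomial τ ℤ}
    (hi : v i = 1) (hj : ∀ t, v (j t) = MvPolynomial.X t) (hs : ∀ s, s = i ∨ ∃ t, j t = s) :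
    IsOpenImmersion (point v (span_eq_top_of_one v i hi)) ∧
      Set.range (point v (span_eq_top_of_one v i hi)) =
        (formOpen (MvPolynomial.X i) : Set (ProjSpace σ)) := by
  have hX := MvPolynomial.isHomogeneous_X ℤ i
  have hu : IsUnit (MvPolynomial.aeval (R := ℤ) v (MvPolynomial.X i)) := by simp [hi]
  -- Dehomogenization is an isomorphism from the ring of `D₊(X i)` to the polynomial ring: a form is
  -- determined by its dehomogenization, and `X (j t) / X i` maps to the variable `X t`.
  have hbij : Function.Bijective (evalAway v hu) := by
    constructor
    · rw [injective_iff_map_eq_zero]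
      intro x hx
      obtain ⟨k, y, hy, rfl⟩ := HomogeneousLocalization.Away.mk_surjective _
        ((MvPolynomial.mem_homogeneousSubmodule 1 _).mpr hX) x
      have h := evalAway_mk v hu ((MvPolynomial.mem_homogeneousSubmodule 1 _).mpr hX) k y hy
      rw [hx, zero_mul] at h
      have hy0 : y = 0 := eq_zero_of_aeval_eq_zero hi hj hs (n := k) (by simpa using hy) h.symm
      apply HomogeneousLocalization.val_injective
      simp [HomogeneousLocalization.Away.val_mk, hy0, Localization.mk_zero]
    · refine surjective_of_X_mem_range (evalAway v hu) fun t =>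
        ⟨formFrac hX (MvPolynomial.isHomogeneous_X ℤ (j t)), ?_⟩
      have := evalAway_formFrac v hX (MvPolynomial.isHomogeneous_X ℤ (j t)) hu
      rwa [MvPolynomial.aeval_X, MvPolynomial.aeval_X, hi, hj, one_mul] at this
  have hiso : IsIso (CommRingCat.ofHom (evalAway v hu)) :=
    (RingEquiv.ofBijective (evalAway v hu) hbij).toCommRingCatIso.isIso_hom
  have hsurj : Function.Surjective (Spec.map (CommRingCat.ofHom (evalAway v hu))) :=
    (Spec.map (CommRingCat.ofHom (evalAway v hu))).homeomorph.surjective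
  rw [point_eq v _ hu one_pos hX]
  refine ⟨inferInstance, ?_⟩
  rw [← range_formι hX one_pos, Scheme.Hom.comp_base, TopCat.coe_comp, Set.range_comp,
    Set.range_eq_univ.mpr hsurj, Set.image_univ]

instance (f : MvPolynomial σ ℤ) : IsReduced (AwayRing f) := by
  have : IsReduced (Localization.Away f) :=
    inferInstance
  exact isReduced_of_injective (algebraMap (AwayRing f) (Localization.Away f))
    (HomogeneousLocalization.val_injective _)

lemma exists_mem_formOpen (x : ProjSpace σ) : ∃ i, x ∈ formOpen (MvPolynomial.X i) := by
  have h := Proj.iSup_basicOpen_eq_top' (MvPolynomial.homogeneousSubmodule σ ℤ)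
    (fun i : σ => (MvPolynomial.X i : MvPolynomial σ ℤ))
    (fun i => ⟨1, (MvPolynomial.mem_homogeneousSubmodule 1 _).mpr
      (MvPolynomial.isHomogeneous_X ℤ i)⟩) (by
      rw [eq_top_iff]
      intro y _
      induction y using MvPolynomial.induction_on with
      | C a =>
        rw [show (MvPolynomial.C a : MvPolynomial σ ℤ) = (a : MvPolynomial σ ℤ) by simp]
        exact intCast_mem _ a
      | add p q hp hq => exact add_mem (hp trivial) (hq trivial)
      | mul_X p t hp => exact mul_mem (hp trivial) (Algebra.subset_adjoin ⟨t, rfl⟩))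
  exact TopologicalSpace.Opens.mem_iSup.mp (h.ge (Set.mem_univ x))

instance : IsReduced (ProjSpace σ) := by
  have (x : ProjSpace σ) : _root_.IsReduced ((ProjSpace σ).presheaf.stalk x) := by
    obtain ⟨i, hi⟩ := exists_mem_formOpen x
    have hX := MvPolynomial.isHomogeneous_X ℤ i
    rw [← SetLike.mem_coe, ← range_formι hX one_pos] at hi
    obtain ⟨y, rfl⟩ := hi
    exact isReduced_of_injective _
      (asIso <| (formι hX one_pos).stalkMap y).commRingCatIsoToRingEquiv.injective
  exact isReduced_of_isReduced_stalk _

instance : (ProjSpace σ).IsSeparated :=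
  inferInstanceAs (Proj (MvPolynomial.homogeneousSubmodule σ ℤ)).IsSeparated

lemma genPoint_mem_formOpen [Nonempty σ] {f : MvPolynomial σ ℤ} (hf : f ≠ 0) :
    (genPoint : ProjSpace σ) ∈ formOpen f := by
  change f ∉ (⊥ : HomogeneousIdeal (MvPolynomial.homogeneousSubmodule σ ℤ)).toIdeal
  rwa [HomogeneousIdeal.toIdeal_bot, Ideal.mem_bot]

lemma dense_formOpen [Nonempty σ] {f : MvPolynomial σ ℤ} (hf : f ≠ 0) :
    Dense (formOpen f : Set (ProjSpace σ)) :=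
  (formOpen f).isOpen.dense ⟨_, genPoint_mem_formOpen hf⟩

/-- The rational self-map of projective space given by forms `F` of the same degree, as a
morphism on the open subscheme `D₊(F i)`. -/
noncomputable def formMap [Nonempty σ] {F : σ → MvPolynomial σ ℤ} {m : ℕ} (hm : 0 < m)
    (hF : ∀ j, (F j).IsHomogeneous m) (i : σ) (hi : F i ≠ 0) :
    (ProjSpace σ).PartialMap (ProjSpace σ) where
  domain := formOpen (F i)
  dense_domain := dense_formOpen hi
  hom := (formOpenIso (hF i) hm).hom ≫
    point (fun j => formFrac (hF i) (hF j)) (span_eq_top_of_one _ i (formFrac_self (hF i)))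

/-- On `D₊(F i)` the map has coordinates `F j / F i`; after evaluation, scaling by the unit `F i
(v)` clears the denominator. -/
lemma sends_formMap [Nonempty σ] {F : σ → MvPolynomial σ ℤ} {m : ℕ} (hm : 0 < m)
    (hF : ∀ j, (F j).IsHomogeneous m) (i : σ) (hi : F i ≠ 0) (v : σ → A)
    (hv : Ideal.span (Set.range v) = ⊤) (hu : IsUnit (MvPolynomial.aeval v (F i)))
    (hFv : Ideal.span (Set.range fun j => MvPolynomial.aeval v (F j)) = ⊤) :
    Sends (formMap hm hF i hi).toRationalMap (point v hv)
      (point (fun j => MvPolynomial.aeval v (F j)) hFv) := by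
  have h1 : Spec.map (CommRingCat.ofHom (evalAway v hu)) ≫ (formOpenIso (hF i) hm).inv ≫
      (formOpen (F i)).ι = point v hv := (point_eq v hv hu hm (hF i)).symm
  have h2 : Spec.map (CommRingCat.ofHom (evalAway v hu)) ≫
      point (fun j => formFrac (hF i) (hF j)) (span_eq_top_of_one _ i (formFrac_self (hF i))) =
        point (fun j => MvPolynomial.aeval v (F j)) hFv := by
    rw [Spec_map_point _ _ _ (f := MvPolynomial.X i) ?_ one_pos
      (MvPolynomial.isHomogeneous_X ℤ i)]
    · exact point_smul (MvPolynomial.aeval v (F i))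
        (fun j => (evalAway_formFrac v (hF i) (hF j) hu).symm) _ _ hu
    · rw [MvPolynomial.aeval_X, formFrac_self]
      exact isUnit_one
  rw [← h1, ← h2]
  exact sends_toRationalMap (dense_formOpen hi) (formOpenIso (hF i) hm) _ _

end Charts

/-! ### Fibres over `Spec ℤ` and dominance -/

section Fibres

attribute [local instance] MvPolynomial.gradedAlgebra

variable {σ τ : Type}

lemma mem_fibre_Spec {R : Type} [CommRing R] (s : Spec (.of ℤ)) (x : Spec (.of R)) :
    x ∈ fibre (Spec (.of R)) s ↔ ∀ n : ℤ, n ∈ s.asIdeal ↔ (n : R) ∈ x.asIdeal := by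
  have h : specZIsTerminal.from (Spec (.of R)) =
      Spec.map (CommRingCat.ofHom (Int.castRingHom R)) := specZIsTerminal.hom_ext _ _
  rw [fibre, Set.mem_ofPred_eq, h, eq_comm]
  exact (PrimeSpectrum.ext_iff (R := ℤ)).trans SetLike.ext_iff

/-- `Spec ℤ` is terminal, so every morphism of schemes respects the fibres. -/
lemma mem_fibre_comp {X Y : Scheme.{0}} (f : X ⟶ Y) (s : Spec (.of ℤ)) (x : X) :
    f x ∈ fibre Y s ↔ x ∈ fibre X s := by
  rw [fibre, fibre, Set.mem_ofPred_eq, Set.mem_ofPred_eq, ← Scheme.Hom.comp_apply,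
    specZIsTerminal.hom_ext (f ≫ specZIsTerminal.from Y) (specZIsTerminal.from X)]

instance (s : Spec (.of ℤ)) : IsDomain (ℤ ⧸ s.asIdeal) :=
  (Ideal.Quotient.isDomain_iff_prime (R := ℤ) s.asIdeal).mpr s.isPrime

/-- Reduction of integral polynomials to the residue ring of a point of `Spec ℤ`. -/
noncomputable def reduction (τ : Type) (s : Spec (.of ℤ)) :
    MvPolynomial τ ℤ →+* MvPolynomial τ (ℤ ⧸ s.asIdeal) :=
  MvPolynomial.map (Ideal.Quotient.mk s.asIdeal)

/-- The generic point of the fibre of affine space over a point of `Spec ℤ`. -/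
noncomputable def fibreGenPoint (τ : Type) (s : Spec (.of ℤ)) : Aff τ :=
  (⟨RingHom.ker (reduction τ s), RingHom.ker_isPrime _⟩ : PrimeSpectrum (MvPolynomial τ ℤ))

lemma mem_fibreGenPoint {s : Spec (.of ℤ)} {p : MvPolynomial τ ℤ} :
    p ∈ (fibreGenPoint τ s).asIdeal ↔ reduction τ s p = 0 := RingHom.mem_ker

lemma fibreGenPoint_mem_fibre (s : Spec (.of ℤ)) : fibreGenPoint τ s ∈ fibre (Aff τ) s := by
  rw [mem_fibre_Spec]
  intro n
  rw [mem_fibreGenPoint, map_intCast, ← map_intCast (MvPolynomial.C (R := ℤ ⧸ s.asIdeal)),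
    MvPolynomial.C_eq_zero, ← map_intCast (Ideal.Quotient.mk s.asIdeal), Int.cast_id,
    Ideal.Quotient.eq_zero_iff_mem]

/-- The kernel of reduction is generated by the constants lying in `s`. -/
lemma mem_of_reduction_eq_zero {R : Type} [CommRing R] (φ : MvPolynomial τ ℤ →+* R) (I : Ideal R)
    {s : Spec (.of ℤ)} (hs : ∀ n ∈ s.asIdeal, φ (MvPolynomial.C n) ∈ I) {p : MvPolynomial τ ℤ}
    (hp : reduction τ s p = 0) : φ p ∈ I := by
  rw [p.as_sum, map_sum]
  refine sum_mem fun d _ => ?_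
  rw [← mul_one (MvPolynomial.coeff d p), ← MvPolynomial.C_mul_monomial, map_mul]
  refine Ideal.mul_mem_right _ _ (hs _ ?_)
  rw [← Ideal.Quotient.eq_zero_iff_mem, ← MvPolynomial.coeff_map]
  exact (congrArg (MvPolynomial.coeff d) hp).trans (MvPolynomial.coeff_zero d)

lemma fibre_subset_closure (s : Spec (.of ℤ)) :
    fibre (Aff τ) s ⊆ closure {fibreGenPoint τ s} := by
  intro x hx
  rw [mem_fibre_Spec] at hx
  refine (PrimeSpectrum.le_iff_mem_closure _ _).mp (show (fibreGenPoint τ s).asIdeal ≤ x.asIdeal from ?_)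
  intro p hp
  refine mem_of_reduction_eq_zero (RingHom.id _) x.asIdeal (fun n hn => ?_)
    (mem_fibreGenPoint.mp hp)
  have := (hx n).mp hn
  rwa [← map_intCast (MvPolynomial.C (R := ℤ)), Int.cast_id] at this

/-- The polynomials `e` remain algebraically independent modulo every prime. -/
def IndependentOnFibres (e : τ → MvPolynomial τ ℤ) : Prop :=
  ∀ s : Spec (.of ℤ), AlgebraicIndependent (ℤ ⧸ s.asIdeal) fun t => reduction τ s (e t)

lemma reduction_aeval {s : Spec (.of ℤ)} (e : σ → MvPolynomial τ ℤ) (p : MvPolynomial σ ℤ) :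
    reduction τ s (MvPolynomial.aeval e p) =
      MvPolynomial.aeval (fun t => reduction τ s (e t)) (reduction σ s p) := by
  have : (reduction τ s).comp (MvPolynomial.aeval (R := ℤ) e).toRingHom =
      (MvPolynomial.aeval fun t => reduction τ s (e t)).toRingHom.comp (reduction σ s) :=
    MvPolynomial.ringHom_ext (fun r => by simp) (fun i => by simp [reduction])
  exact RingHom.congr_fun this p

/-- Independence modulo `s` says exactly that substituting `e` pulls the kernel of reduction back to
itself. -/
lemma polyMap_fibreGenPoint {e : τ → MvPolynomial τ ℤ} (he : IndependentOnFibres e)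
    (s : Spec (.of ℤ)) : polyMap e (fibreGenPoint τ s) = fibreGenPoint τ s := by
  refine PrimeSpectrum.ext (SetLike.ext fun p => ?_)
  refine Iff.trans (b := reduction τ s (MvPolynomial.aeval e p) = 0) mem_fibreGenPoint ?_
  rw [mem_fibreGenPoint, reduction_aeval]
  exact map_eq_zero_iff _ (he s)

/-- It suffices to follow the generic point of each fibre. It is fixed by `polyMap e`, so its image
under `x` is a value of `f` at a point of that fibre, and this value specializes to the whole fibre.
-/
lemma dominantOnFibres_of_sends {X : Scheme.{0}} {f : X ⤏ X} {e : τ → MvPolynomial τ ℤ}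
    (he : IndependentOnFibres e) (x : Aff τ ⟶ X) (hf : Sends f x (polyMap e ≫ x))
    (hx : ∀ s, fibre X s ⊆ closure {x (fibreGenPoint τ s)}) : DominantOnFibres f := by
  obtain ⟨g, rfl, x', h1, h2⟩ := hf
  refine ⟨g, rfl, fun s => (hx s).trans (closure_mono ?_)⟩
  rw [Set.singleton_subset_iff]
  refine ⟨x' (fibreGenPoint τ s), ?_, ?_⟩
  · rw [Set.mem_preimage, ← Scheme.Hom.comp_apply, h1, mem_fibre_comp]
    exact fibreGenPoint_mem_fibre s
  · rw [← Scheme.Hom.comp_apply, h2, Scheme.Hom.comp_apply, polyMap_fibreGenPoint he]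

lemma sends_of_hom {X Y T : Scheme.{0}} (f : X ⟶ Y) (x : T ⟶ X) :
    Sends f.toRationalMap x (x ≫ f) :=
  ⟨f.toPartialMap, rfl, x ≫ X.topIso.inv,
    (Category.assoc _ _ _).trans ((congrArg (x ≫ ·) X.topIso.inv_hom_id).trans
      (Category.comp_id x)),
    (Category.assoc _ _ _).trans (congrArg (x ≫ ·) (Iso.inv_hom_id_assoc X.topIso f))⟩

lemma dominantOnFibres_polyMap {e : τ → MvPolynomial τ ℤ} (he : IndependentOnFibres e) :
    DominantOnFibres (polyMap e).toRationalMap := by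
  refine dominantOnFibres_of_sends he (𝟙 _) ?_ fun s => fibre_subset_closure s
  have := sends_of_hom (polyMap e) (𝟙 _)
  rwa [Category.id_comp, ← Category.comp_id (polyMap e)] at this

lemma DominantOnFibres.isDominant {X : Scheme.{0}} {f : X ⤏ X} (hf : DominantOnFibres f) :
    f.IsDominant := by
  obtain ⟨g, rfl, h⟩ := hf
  rw [Scheme.PartialMap.isDominant_toRationalMap_iff]
  refine ⟨fun x => ?_⟩
  exact closure_mono (Set.image_subset_range _ _) (h _ (show x ∈ fibre X _ from rfl))

lemma isDominant_polyMap {e : τ → MvPolynomial τ ℤ} (he : IndependentOnFibres e) :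
    IsDominant (polyMap e) := by
  have h := (dominantOnFibres_polyMap he).isDominant
  rw [Scheme.PartialMap.isDominant_toRationalMap_iff] at h
  exact IsDominant.of_comp (H := h) (Aff τ).topIso.hom (polyMap e)

/-- The homogeneous prime ideal of a point of projective space. -/
noncomputable def formIdeal (x : ProjSpace σ) : Ideal (MvPolynomial σ ℤ) :=
  (show ProjectiveSpectrum (MvPolynomial.homogeneousSubmodule σ ℤ) from
    x).asHomogeneousIdeal.toIdeal

lemma isPrime_formIdeal (x : ProjSpace σ) : (formIdeal x).IsPrime :=
  (show ProjectiveSpectrum (MvPolynomial.homogeneousSubmodule σ ℤ) from x).isPrime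

/-- On `D₊(n X i)` the integer `n` is invertible, with inverse `X i / (n X i)`, so no point there
lies over a prime containing `n`. -/
lemma C_mul_mem_of_mem_fibre {s : Spec (.of ℤ)} {x : ProjSpace σ} (hx : x ∈ fibre (ProjSpace σ) s)
    {n : ℤ} (hn : n ∈ s.asIdeal) (i : σ) :
    x ∉ formOpen (MvPolynomial.C n * MvPolynomial.X i) := by
  intro h
  have hX : (MvPolynomial.C n * MvPolynomial.X i : MvPolynomial σ ℤ).IsHomogeneous 1 :=
    (MvPolynomial.isHomogeneous_X ℤ i).C_mul n
  rw [← SetLike.mem_coe, ← range_formι hX one_pos] at h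
  obtain ⟨y, rfl⟩ := h
  rw [mem_fibre_comp, mem_fibre_Spec] at hx
  refine y.isPrime.ne_top ((Ideal.eq_top_iff_one _).mpr ?_)
  have h1 : (1 : AwayRing (MvPolynomial.C n * MvPolynomial.X i)) =
      n * formFrac hX (MvPolynomial.isHomogeneous_X ℤ i) := by
    rw [← formFrac_self hX]
    apply HomogeneousLocalization.val_injective
    rw [HomogeneousLocalization.val_mul, HomogeneousLocalization.val_intCast, formFrac, formFrac,
      HomogeneousLocalization.Away.val_mk, HomogeneousLocalization.Away.val_mk,
      Localization.mk_eq_mk', IsLocalization.mk'_eq_iff_eq_mul, mul_assoc]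
    refine Eq.trans ?_ (congrArg _ (IsLocalization.mk'_spec (Localization.Away _) _ _).symm)
    simp
  rw [h1]
  exact Ideal.mul_mem_right _ _ ((hx n).mp hn)

lemma fibre_subset_closure_point {i : σ} {j : τ → σ}
    {v : σ → MvPolynomial τ ℤ} (hi : v i = 1) (hj : ∀ t, v (j t) = MvPolynomial.X t)
    (hs : ∀ s, s = i ∨ ∃ t, j t = s) (hv : Ideal.span (Set.range v) = ⊤) (s : Spec (.of ℤ)) :
    fibre (ProjSpace σ) s ⊆ closure {point v hv (fibreGenPoint τ s)} := by
  intro x hx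
  obtain ⟨l, hl⟩ := exists_mem_formOpen x
  have hC : ∀ n ∈ s.asIdeal, MvPolynomial.C n ∈ formIdeal x := fun n hn =>
    ((isPrime_formIdeal x).mem_or_mem (not_not.mp (C_mul_mem_of_mem_fibre hx hn l))).resolve_right
      hl
  refine (ProjectiveSpectrum.le_iff_mem_closure
      (𝒜 := MvPolynomial.homogeneousSubmodule σ ℤ) (point v hv (fibreGenPoint τ s)) x).mp ?_
  intro f hf
  change f ∈ formIdeal x
  rw [← MvPolynomial.sum_homogeneousComponent f]
  refine sum_mem fun k _ => ?_
  have hk : MvPolynomial.homogeneousComponent k f ∈ formIdeal (point v hv (fibreGenPoint τ s)) := by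
    have := (point v hv (fibreGenPoint τ s)).asHomogeneousIdeal.isHomogeneous k hf
    rwa [← MvPolynomial.decomposition.decompose'_apply]
  -- The factor `X l`, which does not vanish at `x`, makes the degree positive even for `k = 0`, as
  -- the standard opens require.
  have hh : (MvPolynomial.homogeneousComponent k f * MvPolynomial.X l).IsHomogeneous (k + 1) :=
    (MvPolynomial.homogeneousComponent_isHomogeneous k f).mul (MvPolynomial.isHomogeneous_X ℤ l)
  have h1 : point v hv (fibreGenPoint τ s) ∉
      formOpen (MvPolynomial.homogeneousComponent k f * MvPolynomial.X l) :=
    not_not.mpr (Ideal.mul_mem_right _ _ hk)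
  rw [point_mem_formOpen v hv hh k.succ_pos, not_not, mem_fibreGenPoint] at h1
  replace h1 := (reduction_aeval v _).symm.trans h1
  have h2 := eq_zero_of_aeval_eq_zero (by rw [hi, map_one])
    (fun t => by rw [hj, reduction, MvPolynomial.map_X]) hs
    (hh.map (Ideal.Quotient.mk s.asIdeal)) h1
  exact ((isPrime_formIdeal x).mem_or_mem
    (mem_of_reduction_eq_zero (RingHom.id _) (formIdeal x) hC h2)).resolve_right hl

end Fibres
-- The norm over roots of unity as a resultant
section Cofactor

open Polynomial

variable {A B : Type*} [CommRing A] [CommRing B]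

/-- The polynomial `q (u Y)` in `Y` over the polynomials in `u`. -/
noncomputable def scaled (q : A[X]) : A[X][X] := (q.map C).comp (C X * X)

lemma natDegree_scaled_le (q : A[X]) : (scaled q).natDegree ≤ q.natDegree := by
  refine natDegree_comp_le.trans ?_
  calc (q.map C).natDegree * (C X * X : A[X][X]).natDegree ≤ q.natDegree * 1 :=
        Nat.mul_le_mul natDegree_map_le ((natDegree_C_mul_le _ _).trans natDegree_X_le)
    _ = q.natDegree := mul_one _

/-- The resultant of `1 + Y + ⋯ + Y ^ (m - 1)` and `q (u Y)` with respect to `Y`, that is, the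
product of the polynomials `q (ζ u)` over the nontrivial `m`-th roots of unity `ζ`; here `n` is a
bound for the degree of `q`. -/
noncomputable def cofactor (m n : ℕ) (q : A[X]) : A[X] :=
  resultant (∑ i ∈ Finset.range m, (X : A[X][X]) ^ i) (scaled q) (m - 1) n

lemma natDegree_geomSum_le (m : ℕ) :
    (∑ i ∈ Finset.range m, (X : A[X][X]) ^ i).natDegree ≤ m - 1 :=
  natDegree_sum_le_of_forall_le _ _ fun i hi =>
    (natDegree_X_pow_le i).trans (by have := Finset.mem_range.mp hi; omega)

lemma coeff_geomSum {m : ℕ} (hm : 0 < m) :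
    (∑ i ∈ Finset.range m, (X : A[X][X]) ^ i).coeff (m - 1) = 1 := by
  rw [finsetSum_coeff, Finset.sum_eq_single (m - 1)]
  · simp
  · intro i _ hi
    rw [coeff_X_pow, if_neg hi.symm]
  · intro h
    exact absurd (Finset.mem_range.mpr (by omega)) h

/-- Raising the degree bound multiplies a resultant by a power of the leading coefficient of the
other polynomial. Here that is `1`, so the bound `n` is immaterial. -/
lemma cofactor_eq {m n : ℕ} (hm : 0 < m) {q : A[X]} (hq : q.natDegree ≤ n) :
    cofactor m n q = resultant (∑ i ∈ Finset.range m, (X : A[X][X]) ^ i) (scaled q) (m - 1)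
      (scaled q).natDegree := by
  obtain ⟨k, rfl⟩ := Nat.exists_eq_add_of_le ((natDegree_scaled_le q).trans hq)
  rw [cofactor, resultant_add_right_deg _ _ _ _ _ le_rfl, coeff_geomSum hm, one_pow, one_mul]

lemma cofactor_eq_of_le {m n n' : ℕ} (hm : 0 < m) {q : A[X]} (hq : q.natDegree ≤ n)
    (hq' : q.natDegree ≤ n') : cofactor m n q = cofactor m n' q := by
  rw [cofactor_eq hm hq, cofactor_eq hm hq']

lemma cofactor_map (φ : A →+* B) (m n : ℕ) (q : A[X]) :
    cofactor m n (q.map φ) = (cofactor m n q).map φ := by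
  have h1 : (∑ i ∈ Finset.range m, (X : B[X][X]) ^ i) =
      (∑ i ∈ Finset.range m, (X : A[X][X]) ^ i).map (mapRingHom φ) := by
    simp [Polynomial.map_sum]
  have h2 : scaled (q.map φ) = (scaled q).map (mapRingHom φ) := by
    rw [scaled, scaled, map_comp, map_map, map_map]
    congr 1
    · congr 1
      ext : 1
      simp
    · simp
  rw [cofactor, h1, h2, resultant_map_map]
  rfl

lemma cofactor_C_mul (m n : ℕ) (c : A) (q : A[X]) :
    cofactor m n (C c * q) = C (c ^ (m - 1)) * cofactor m n q := by
  have : scaled (C c * q) = C (C c) * scaled q := by simp [scaled]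
  rw [cofactor, this, resultant_C_mul_right, cofactor, C_pow]

lemma cofactor_mul {m a b : ℕ} (hm : 0 < m) {p q : A[X]} (hp : p.natDegree ≤ a)
    (hq : q.natDegree ≤ b) :
    cofactor m (a + b) (p * q) = cofactor m a p * cofactor m b q := by
  have h : scaled (p * q) = scaled p * scaled q := by simp [scaled]
  have hle : (scaled p * scaled q).natDegree ≤ (scaled p).natDegree + (scaled q).natDegree :=
    natDegree_mul_le
  rw [cofactor_eq hm hp, cofactor_eq hm hq,
    cofactor_eq hm (natDegree_mul_le.trans (add_le_add hp hq)), h,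
    ← resultant_mul_right _ _ _ _ (natDegree_geomSum_le m)]
  obtain ⟨k, hk⟩ := Nat.exists_eq_add_of_le hle
  rw [hk, resultant_add_right_deg _ _ _ _ _ le_rfl, coeff_geomSum hm, one_pow, one_mul]

lemma cofactor_one {m n : ℕ} (hm : 0 < m) : cofactor m n (1 : A[X]) = 1 := by
  rw [cofactor_eq_of_le (n' := 0) hm (by simp) (by simp), cofactor,
    show scaled (1 : A[X]) = C 1 by simp [scaled], resultant_C_zero_right, one_pow]

lemma natDegree_one_sub_C_mul_X_le (a : A) : (1 - C a * X).natDegree ≤ 1 := by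
  refine (natDegree_sub_le _ _).trans ?_
  rw [natDegree_one, Nat.zero_max]
  exact (natDegree_C_mul_le _ _).trans natDegree_X_le

lemma resultant_one_sub_C_mul_X_of_ne_zero {K : Type*} [Field K] {m : ℕ} (hm : 0 < m) {x : K}
    (hx : x ≠ 0) :
    resultant (∑ i ∈ Finset.range m, (X : K[X]) ^ i) (1 - C x * X) (m - 1) 1 =
      ∑ i ∈ Finset.range m, x ^ i := by
  have h : (1 - C x * X : K[X]) = C (-x) * (X - C x⁻¹) := by
    rw [mul_sub, ← C_mul, neg_mul, mul_inv_cancel₀ hx, C_neg, C_neg, C_1]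
    ring
  have hdeg : (∑ i ∈ Finset.range m, (X : K[X]) ^ i).natDegree ≤ m - 1 :=
    natDegree_sum_le_of_forall_le _ _ fun i hi =>
      (natDegree_X_pow_le i).trans (by have := Finset.mem_range.mp hi; omega)
  -- The resultant is `x ^ (m - 1)` times the geometric sum at `x⁻¹`; reversing the order of
  -- summation turns this into the geometric sum at `x`.
  rw [h, resultant_C_mul_right, resultant_X_sub_C_right _ _ _ hdeg, ← mul_assoc, ← mul_pow,
    eval_finsetSum, Finset.mul_sum, ← Finset.sum_range_reflect]
  refine Finset.sum_congr rfl fun i hi => ?_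
  have hi' := Finset.mem_range.mp hi
  rw [eval_pow, eval_X, inv_pow, mul_neg_one, neg_neg, ← div_eq_mul_inv,
    div_eq_iff (pow_ne_zero _ hx), ← pow_add]
  congr 1
  omega

lemma map_geomSum (φ : A →+* B) (m : ℕ) :
    (∑ i ∈ Finset.range m, (X : A[X]) ^ i).map φ = ∑ i ∈ Finset.range m, (X : B[X]) ^ i := by
  simp [Polynomial.map_sum]

lemma map_one_sub_C_mul_X (φ : A →+* B) (a : A) :
    (1 - C a * X : A[X]).map φ = 1 - C (φ a) * X := by simp

/-- The universal case, with `x` the variable of `ℤ[X]`, follows in the fraction field and then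
specializes to any commutative ring. -/
lemma resultant_one_sub_C_mul_X {m : ℕ} (hm : 0 < m) (x : A) :
    resultant (∑ i ∈ Finset.range m, (X : A[X]) ^ i) (1 - C x * X) (m - 1) 1 =
      ∑ i ∈ Finset.range m, x ^ i := by
  have key : resultant (∑ i ∈ Finset.range m, (X : ℤ[X][X]) ^ i) (1 - C X * X) (m - 1) 1 =
      ∑ i ∈ Finset.range m, (X : ℤ[X]) ^ i := by
    have hinj := IsFractionRing.injective ℤ[X] (FractionRing ℤ[X])
    refine hinj ?_
    rw [← resultant_map_map, map_geomSum, map_one_sub_C_mul_X, resultant_one_sub_C_mul_X_of_ne_zero hm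
      ((map_ne_zero_iff _ hinj).mpr (X_ne_zero (R := ℤ))), map_sum]
    simp only [map_pow]
  have h := congrArg (eval₂RingHom (Int.castRingHom A) x) key
  rw [← resultant_map_map, map_geomSum, map_one_sub_C_mul_X, map_sum] at h
  have hx : eval₂RingHom (Int.castRingHom A) x X = x := eval₂_X _ _
  rw [hx] at h
  simpa only [map_pow, hx] using h

lemma cofactor_one_sub_C_mul_X {m : ℕ} (hm : 0 < m) (a : A) :
    cofactor m 1 (1 - C a * X) = ∑ i ∈ Finset.range m, (C a * X) ^ i := by
  rw [cofactor, show scaled (1 - C a * X) = 1 - C (C a * X) * X by simp [scaled, mul_assoc]]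
  exact resultant_one_sub_C_mul_X hm _

lemma natDegree_prod_one_sub_le {ι : Type*} (s : Finset ι) (α : ι → A) :
    (∏ i ∈ s, (1 - C (α i) * X)).natDegree ≤ s.card := by
  refine (natDegree_prod_le _ _).trans ((Finset.sum_le_card_nsmul _ _ 1 fun i _ =>
    natDegree_one_sub_C_mul_X_le _).trans (by simp))

lemma cofactor_prod {ι : Type*} {m : ℕ} (hm : 0 < m) (s : Finset ι) (α : ι → A) :
    cofactor m s.card (∏ i ∈ s, (1 - C (α i) * X)) =
      ∏ i ∈ s, ∑ j ∈ Finset.range m, (C (α i) * X) ^ j := by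
  classical
  induction s using Finset.induction_on with
  | empty => simp [cofactor_one hm]
  | insert i s hi ih =>
    rw [Finset.prod_insert hi, Finset.prod_insert hi, Finset.card_insert_of_notMem hi, add_comm,
      cofactor_mul hm (natDegree_one_sub_C_mul_X_le _) (natDegree_prod_one_sub_le s α), ih,
      cofactor_one_sub_C_mul_X hm]

/-- Factor by factor this is `(1 - αX)(1 + αX + ⋯ + (αX) ^ (m - 1)) = 1 - (αX) ^ m`. No root of
unity is needed, so the formula survives when the characteristic divides `m`. -/
lemma prod_mul_cofactor {ι : Type*} {m n : ℕ} (hm : 0 < m) (s : Finset ι) (hn : s.card ≤ n)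
    (α : ι → A) :
    (∏ i ∈ s, (1 - C (α i) * X)) * cofactor m n (∏ i ∈ s, (1 - C (α i) * X)) =
      expand A m (∏ i ∈ s, (1 - C (α i ^ m) * X)) := by
  rw [cofactor_eq_of_le hm ((natDegree_prod_one_sub_le s α).trans hn)
    (natDegree_prod_one_sub_le s α), cofactor_prod hm, ← Finset.prod_mul_distrib, map_prod]
  refine Finset.prod_congr rfl fun i _ => ?_
  rw [mul_neg_geom_sum]
  simp [mul_pow]

lemma natDegree_cofactor_prod_le {ι : Type*} {m n : ℕ} (hm : 0 < m) (s : Finset ι)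
    (hn : s.card ≤ n) (α : ι → A) :
    (cofactor m n (∏ i ∈ s, (1 - C (α i) * X))).natDegree ≤ n * (m - 1) := by
  rw [cofactor_eq_of_le hm ((natDegree_prod_one_sub_le s α).trans hn)
    (natDegree_prod_one_sub_le s α), cofactor_prod hm]
  refine (natDegree_prod_le _ _).trans ((Finset.sum_le_card_nsmul _ _ (m - 1) fun i _ => ?_).trans
    (Nat.mul_le_mul_right _ hn))
  refine natDegree_sum_le_of_forall_le _ _ fun j hj => ?_
  refine natDegree_pow_le.trans ?_
  have h1 : (C (α i) * X).natDegree ≤ 1 := (natDegree_C_mul_le _ _).trans natDegree_X_le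
  have := Finset.mem_range.mp hj
  calc j * (C (α i) * X).natDegree ≤ j * 1 := Nat.mul_le_mul_left _ h1
    _ ≤ m - 1 := by omega

/-- The geometric sum splits into `Y - ζ ^ i` over the nontrivial powers, and the resultant with a
linear factor is evaluation at its root. This links the resultant to the averaging definition of the
transform. -/
lemma cofactor_eq_prod [IsDomain A] {m n : ℕ} (hm : 0 < m) {ζ : A} (hζ : IsPrimitiveRoot ζ m)
    {q : A[X]} (hq : q.natDegree ≤ n) :
    cofactor m n q = ∏ i ∈ Finset.range (m - 1), q.comp (C (ζ ^ (i + 1)) * X) := by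
  have hz : IsPrimitiveRoot (C ζ) m := hζ.map_of_injective C_injective
  have hprod : (∑ i ∈ Finset.range m, (X : A[X][X]) ^ i) =
      ∏ i ∈ Finset.range (m - 1), (X - C (C (ζ ^ (i + 1)))) := by
    refine mul_right_cancel₀ (X_sub_C_ne_zero (1 : A[X])) ?_
    have h1 := X_pow_sub_C_eq_prod hz hm (one_pow m)
    rw [← Nat.sub_add_cancel hm, Finset.prod_range_succ', Nat.sub_add_cancel hm] at h1
    simp only [mul_one, pow_zero, ← C_pow] at h1
    rw [C_1, geom_sum_mul, ← C_1, h1]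
  have hmonic : ∀ i : ℕ, (X - C (C (ζ ^ (i + 1))) : A[X][X]).Monic := fun i => monic_X_sub_C _
  have hdeg : (∏ i ∈ Finset.range (m - 1), (X - C (C (ζ ^ (i + 1))))).natDegree = m - 1 := by
    rw [natDegree_prod_of_monic _ _ fun i _ => hmonic i,
      Finset.sum_congr rfl fun i _ => natDegree_X_sub_C _]
    simp
  have h2 := resultant_prod_left (Finset.range (m - 1)) (fun i => X - C (C (ζ ^ (i + 1))))
    (scaled q) n (by simp only [(hmonic _).leadingCoeff, Finset.prod_const_one]; exact one_ne_zero)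
    ((natDegree_scaled_le q).trans hq)
  rw [hdeg] at h2
  rw [cofactor, hprod, h2]
  refine Finset.prod_congr rfl fun i _ => ?_
  rw [natDegree_X_sub_C, resultant_X_sub_C_left _ _ _ ((natDegree_scaled_le q).trans hq), scaled,
    eval_comp, eval_mul, eval_C, eval_X, Polynomial.eval_map, comp, mul_comm]

/-- At `u = 0` the polynomial `q (u Y)` is constant, and the resultant with a constant is a power of
it. -/
lemma coeff_zero_cofactor {m : ℕ} (hm : 0 < m) (n : ℕ) (q : A[X]) :
    (cofactor m n q).coeff 0 = q.coeff 0 ^ (m - 1) := by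
  rw [coeff_zero_eq_eval_zero, ← coe_evalRingHom, cofactor, ← resultant_map_map]
  have h2 : (scaled q).map (evalRingHom 0) = C (q.coeff 0) := by
    rw [scaled, map_comp, map_map]
    simp [coeff_zero_eq_eval_zero]
  rw [h2]
  have h3 := resultant_add_right_deg ((∑ i ∈ Finset.range m, (X : A[X][X]) ^ i).map (evalRingHom 0))
    (C (q.coeff 0)) (m - 1) 0 n (by simp)
  rw [zero_add] at h3
  rw [h3, resultant_C_zero_right, coeff_map, coeff_geomSum hm]
  simp

end Cofactor

/-! ### The integral forms defining the map -/

section LandenForms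

open Polynomial

variable {A B : Type*} [CommRing A] [CommRing B]

/-- The numerator of the Landen transform of `p / q`, as a function of `u = 1 / z`. -/
noncomputable def landenNum (m d : ℕ) (p q : A[X]) : A[X] := contract m (p * cofactor m d q)

lemma landenNum_map (φ : A →+* B) {m : ℕ} (hm : 0 < m) (d : ℕ) (p q : A[X]) :
    landenNum m d (p.map φ) (q.map φ) = (landenNum m d p q).map φ := by
  rw [landenNum, landenNum, map_contract hm.ne', Polynomial.map_mul, cofactor_map]

lemma coeff_zero_landenNum {m : ℕ} (hm : 0 < m) (d : ℕ) (p q : A[X]) :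
    (landenNum m d p q).coeff 0 = p.coeff 0 * q.coeff 0 ^ (m - 1) := by
  rw [landenNum, coeff_contract hm.ne', zero_mul, mul_coeff_zero, coeff_zero_cofactor hm]

lemma coeff_zero_landenNum_self {m : ℕ} (hm : 0 < m) (d : ℕ) (q : A[X]) :
    (landenNum m d q q).coeff 0 = q.coeff 0 ^ m := by
  rw [coeff_zero_landenNum hm, ← pow_succ', Nat.sub_add_cancel hm]

lemma landenNum_C_mul {m : ℕ} (hm : 0 < m) (d : ℕ) (c : A) (p q : A[X]) :
    landenNum m d (C c * p) (C c * q) = C (c ^ m) * landenNum m d p q := by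
  rw [landenNum, cofactor_C_mul]
  ext k
  have h : c ^ m = c * c ^ (m - 1) := by rw [← pow_succ', Nat.sub_add_cancel hm]
  rw [landenNum, coeff_C_mul, coeff_contract hm.ne', coeff_contract hm.ne', h, ← coeff_C_mul, C_mul]
  congr 1
  ring

lemma natDegree_contract_le {m n : ℕ} (hm : 0 < m) {p : A[X]} (hp : p.natDegree ≤ n * m) :
    (contract m p).natDegree ≤ n := by
  rw [natDegree_le_iff_coeff_eq_zero]
  intro k hk
  rw [coeff_contract hm.ne']
  exact coeff_eq_zero_of_natDegree_lt (hp.trans_lt (Nat.mul_lt_mul_of_pos_right hk hm))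

lemma natDegree_landenNum_le {m d : ℕ} (hm : 0 < m) {p q : A[X]} (hp : p.natDegree ≤ d)
    (hq : (cofactor m d q).natDegree ≤ d * (m - 1)) : (landenNum m d p q).natDegree ≤ d := by
  refine natDegree_contract_le hm (natDegree_mul_le.trans ((add_le_add hp hq).trans_eq ?_))
  obtain ⟨k, rfl⟩ := Nat.exists_eq_add_of_le' hm
  rw [Nat.add_sub_cancel]
  ring

variable {d : ℕ}

/-- The polynomial with a given coefficient vector, in order of increasing degree. -/
noncomputable def vecPoly (a : Fin (d + 1) → A) : A[X] := ∑ i, C (a i) * X ^ (i : ℕ)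

lemma coeff_vecPoly (a : Fin (d + 1) → A) (i : Fin (d + 1)) : (vecPoly a).coeff i = a i := by
  rw [vecPoly, finsetSum_coeff, Finset.sum_eq_single i]
  · simp
  · intro j _ hj
    rw [coeff_C_mul_X_pow, if_neg fun h => hj (Fin.ext h).symm]
  · simp

lemma coeff_zero_vecPoly (a : Fin (d + 1) → A) : (vecPoly a).coeff 0 = a 0 := coeff_vecPoly a 0

lemma natDegree_vecPoly_le (a : Fin (d + 1) → A) : (vecPoly a).natDegree ≤ d :=
  natDegree_sum_le_of_forall_le _ _ fun i _ =>
    (natDegree_C_mul_X_pow_le _ _).trans (Nat.lt_succ_iff.mp i.2)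

lemma vecPoly_coeff {p : A[X]} (hp : p.natDegree ≤ d) :
    vecPoly (fun i : Fin (d + 1) => p.coeff i) = p := by
  rw [vecPoly, Fin.sum_univ_eq_sum_range fun i => C (p.coeff i) * X ^ i]
  exact (as_sum_range_C_mul_X_pow' p (Nat.lt_succ_iff.mpr hp)).symm

lemma vecPoly_map (φ : A →+* B) (a : Fin (d + 1) → A) :
    (vecPoly a).map φ = vecPoly fun i => φ (a i) := by
  simp [vecPoly, Polynomial.map_sum]

lemma vecPoly_smul (c : A) (a : Fin (d + 1) → A) :
    vecPoly (fun i => c * a i) = C c * vecPoly a := by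
  simp [vecPoly, Finset.mul_sum, mul_assoc]

/-- The forms of degree `m` that define the map induced by the Landen transform. -/
noncomputable def landenForm (d m : ℕ) :
    Fin (d + 1) ⊕ Fin (d + 1) → MvPolynomial (Fin (d + 1) ⊕ Fin (d + 1)) ℤ :=
  Sum.elim
    (fun i => (landenNum m d (vecPoly fun i => MvPolynomial.X (Sum.inl i))
      (vecPoly fun i : Fin (d + 1) => MvPolynomial.X (Sum.inr i))).coeff i)
    (fun i => (landenNum m d (vecPoly fun i => MvPolynomial.X (Sum.inr i))
      (vecPoly fun i : Fin (d + 1) => MvPolynomial.X (Sum.inr i))).coeff i)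

variable {m : ℕ} (hm : 0 < m) (v : Fin (d + 1) ⊕ Fin (d + 1) → A)
include hm

lemma aeval_landenForm_inl (i : Fin (d + 1)) :
    MvPolynomial.aeval v (landenForm d m (Sum.inl i)) =
      (landenNum m d (vecPoly (v ∘ Sum.inl)) (vecPoly (v ∘ Sum.inr))).coeff i := by
  have h := congrArg (fun p => p.coeff (i : ℕ)) (landenNum_map
    (MvPolynomial.aeval (R := ℤ) v).toRingHom hm d (vecPoly fun i => MvPolynomial.X (Sum.inl i))
    (vecPoly fun i : Fin (d + 1) => MvPolynomial.X (Sum.inr i)))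
  simp only [coeff_map, vecPoly_map, AlgHom.toRingHom_eq_coe, RingHom.coe_coe,
    MvPolynomial.aeval_X] at h
  exact h.symm

lemma aeval_landenForm_inr (i : Fin (d + 1)) :
    MvPolynomial.aeval v (landenForm d m (Sum.inr i)) =
      (landenNum m d (vecPoly (v ∘ Sum.inr)) (vecPoly (v ∘ Sum.inr))).coeff i := by
  have h := congrArg (fun p => p.coeff (i : ℕ)) (landenNum_map
    (MvPolynomial.aeval (R := ℤ) v).toRingHom hm d (vecPoly fun i => MvPolynomial.X (Sum.inr i))
    (vecPoly fun i : Fin (d + 1) => MvPolynomial.X (Sum.inr i)))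
  simp only [coeff_map, vecPoly_map, AlgHom.toRingHom_eq_coe, RingHom.coe_coe,
    MvPolynomial.aeval_X] at h
  exact h.symm

omit v in
-- This formula makes the locus `a₀ = 0` stable; the next one does the same for `b₀ ≠ 0` and for the
-- normalization `b₀ = 1`.
lemma landenForm_inl_zero :
    landenForm d m (Sum.inl 0) =
      MvPolynomial.X (Sum.inl 0) * MvPolynomial.X (Sum.inr 0) ^ (m - 1) := by
  refine (coeff_zero_landenNum hm d _ _).trans ?_
  rw [coeff_zero_vecPoly, coeff_zero_vecPoly]

omit v in
lemma landenForm_inr_zero :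
    landenForm d m (Sum.inr 0) = MvPolynomial.X (Sum.inr 0) ^ m := by
  refine (coeff_zero_landenNum_self hm d _).trans ?_
  rw [coeff_zero_vecPoly]

end LandenForms

/-! ### Degree and absence of common factors -/

section Homogeneity

open Polynomial

/-- A polynomial that scales by `c ^ m` when its variables are scaled by `c` is a form of degree
`m`. -/
lemma isHomogeneous_of_aeval_smul {σ : Type} {f : MvPolynomial σ ℤ} {m : ℕ}
    (hf : MvPolynomial.aeval (fun i => (X : (MvPolynomial σ ℤ)[X]) * C (MvPolynomial.X i)) f =
      X ^ m * C f) : f.IsHomogeneous m := by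
  have hC : ∀ g : MvPolynomial σ ℤ,
      MvPolynomial.aeval (fun i => (C (MvPolynomial.X i) : (MvPolynomial σ ℤ)[X])) g = C g := by
    intro g
    exact (aeval_ringHom_comp C MvPolynomial.X g).trans
      (congrArg C (MvPolynomial.aeval_X_left_apply g))
  -- Comparing coefficients of `X ^ m`: the right side gives `f`, while on the left only the
  -- component of degree `m` contributes.
  have h := congrArg (fun p => p.coeff m) hf
  simp only [coeff_X_pow_mul', le_refl, if_true, Nat.sub_self, coeff_C_zero] at h
  rw [← h, ← MvPolynomial.sum_homogeneousComponent f, map_sum, finsetSum_coeff]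
  refine MvPolynomial.IsHomogeneous.sum _ _ _ fun k _ => ?_
  rw [aeval_smul_of_isHomogeneous (MvPolynomial.homogeneousComponent_isHomogeneous k f), hC,
    coeff_X_pow_mul', coeff_C]
  split_ifs with h1 h2
  · have : k = m := by omega
    rw [← this]
    exact MvPolynomial.homogeneousComponent_isHomogeneous k f
  · exact MvPolynomial.isHomogeneous_zero _ _ _
  · exact MvPolynomial.isHomogeneous_zero _ _ _

lemma aeval_smul_landenForm {A : Type} [CommRing A] {d m : ℕ} (hm : 0 < m) (c : A)
    (v : Fin (d + 1) ⊕ Fin (d + 1) → A) (j : Fin (d + 1) ⊕ Fin (d + 1)) :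
    MvPolynomial.aeval (fun i => c * v i) (landenForm d m j) =
      c ^ m * MvPolynomial.aeval v (landenForm d m j) := by
  have h1 : ∀ g : Fin (d + 1) → Fin (d + 1) ⊕ Fin (d + 1),
      vecPoly ((fun i => c * v i) ∘ g) = C c * vecPoly (v ∘ g) := fun g => vecPoly_smul c (v ∘ g)
  rcases j with i | i
  · rw [aeval_landenForm_inl hm, aeval_landenForm_inl hm, h1, h1, landenNum_C_mul hm, coeff_C_mul]
  · rw [aeval_landenForm_inr hm, aeval_landenForm_inr hm, h1, landenNum_C_mul hm, coeff_C_mul]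

lemma isHomogeneous_landenForm {d m : ℕ} (hm : 0 < m) (j : Fin (d + 1) ⊕ Fin (d + 1)) :
    (landenForm d m j).IsHomogeneous m := by
  refine isHomogeneous_of_aeval_smul ?_
  refine (aeval_smul_landenForm hm (X : (MvPolynomial _ ℤ)[X])
    (fun i => C (MvPolynomial.X i)) j).trans (congrArg (X ^ m * ·) ?_)
  exact (aeval_ringHom_comp C MvPolynomial.X _).trans
    (congrArg C (MvPolynomial.aeval_X_left_apply _))

/-- For `q = u ^ d` the norm is `± u ^ (d * m)`, so the last coordinate is `± 1`. For `d ≥ 1` this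
point has `b₀ = 0`, which shows that `b₀` is not a common factor. -/
lemma aeval_landenForm_last {d m : ℕ} (hm : 0 < m) :
    IsUnit (MvPolynomial.aeval (Sum.elim 0 (Pi.single (Fin.last d) (1 : ℤ)))
      (landenForm d m (Sum.inr (Fin.last d)))) := by
  rw [aeval_landenForm_inr hm]
  rw [Sum.elim_comp_inr]
  have h1 : vecPoly (Pi.single (Fin.last d) (1 : ℤ)) = X ^ d := by
    rw [vecPoly, Finset.sum_eq_single (Fin.last d)]
    · simp
    · intro i _ hi
      simp [hi]
    · simp
  have h2 : cofactor m d (X ^ d : ℤ[X]) = C ((-1) ^ ((m - 1) * d)) * X ^ (d * (m - 1)) := by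
    have : scaled (X ^ d : ℤ[X]) = C (X ^ d) * X ^ d := by simp [scaled, mul_pow]
    rw [cofactor, this, resultant_C_mul_right, resultant_X_pow_right _ _ _ (natDegree_geomSum_le m),
      finsetSum_coeff, Finset.sum_eq_single 0]
    · simp [← pow_mul, mul_comm]
    · intro i _ hi
      rw [coeff_X_pow, if_neg hi.symm]
    · intro h
      exact absurd (Finset.mem_range.mpr hm) h
  rw [h1, landenNum, coeff_contract hm.ne', h2, mul_left_comm, ← pow_add, coeff_C_mul, coeff_X_pow,
    Fin.val_last, if_pos]
  · rw [mul_one]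
    exact (isUnit_one.neg).pow _
  · obtain ⟨k, rfl⟩ := Nat.exists_eq_add_of_le' hm
    rw [Nat.add_sub_cancel]
    ring

lemma isUnit_of_forall_dvd_landenForm {d m : ℕ} (hd : 1 ≤ d) (hm : 0 < m)
    {u : MvPolynomial (Fin (d + 1) ⊕ Fin (d + 1)) ℤ} (hu : ∀ j, u ∣ landenForm d m j) :
    IsUnit u := by
  have h0 := hu (Sum.inr 0)
  rw [landenForm_inr_zero hm, dvd_prime_pow (MvPolynomial.X_prime)] at h0
  obtain ⟨k, -, hk⟩ := h0
  rcases Nat.eq_zero_or_pos k with rfl | hk0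
  · rw [pow_zero] at hk
    exact hk.isUnit_iff.mpr isUnit_one
  · have h1 : MvPolynomial.X (Sum.inr 0) ∣ landenForm d m (Sum.inr (Fin.last d)) :=
      ((dvd_pow_self _ hk0.ne').trans hk.symm.dvd).trans (hu _)
    have h2 := map_dvd (MvPolynomial.aeval (Sum.elim 0 (Pi.single (Fin.last d) (1 : ℤ)))) h1
    have h3 : (0 : Fin (d + 1)) ≠ Fin.last d := fun h => by
      have := congrArg Fin.val h
      rw [Fin.val_zero, Fin.val_last] at this
      omega
    rw [MvPolynomial.aeval_X, Sum.elim_inr, Pi.single_eq_of_ne h3, zero_dvd_iff] at h2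
    exact absurd (aeval_landenForm_last hm) (by rw [h2]; exact not_isUnit_zero)

end Homogeneity

/-! ### Composition corresponds to multiplication of indices -/

section Composition

open Polynomial

variable {A : Type*} [CommRing A]

lemma contract_contract {m n : ℕ} (hm : 0 < m) (hn : 0 < n) (f : A[X]) :
    contract m (contract n f) = contract (n * m) f := by
  ext k
  rw [coeff_contract hm.ne', coeff_contract hn.ne', coeff_contract (Nat.mul_pos hn hm).ne']
  congr 1
  ring

lemma landenNum_prod_self {m d : ℕ} (hm : 0 < m) (α : Fin d → A) :
    landenNum m d (∏ i, (1 - C (α i) * X)) (∏ i, (1 - C (α i) * X)) =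
      ∏ i, (1 - C (α i ^ m) * X) := by
  rw [landenNum, prod_mul_cofactor hm _ (by simp), contract_expand _ hm.ne']

lemma prod_one_sub_ne_zero [Nontrivial A] {ι : Type*} (s : Finset ι) (α : ι → A) :
    ∏ i ∈ s, (1 - C (α i) * X) ≠ 0 := by
  intro h
  have := congrArg (eval 0) h
  simp [eval_prod] at this

lemma landenNum_landenNum_prod [IsDomain A] {m n d : ℕ} (hm : 0 < m) (hn : 0 < n) (p : A[X])
    (α : Fin d → A) :
    landenNum m d (landenNum n d p (∏ i, (1 - C (α i) * X)))
      (landenNum n d (∏ i, (1 - C (α i) * X)) (∏ i, (1 - C (α i) * X))) =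
      landenNum (n * m) d p (∏ i, (1 - C (α i) * X)) := by
  have hd : (Finset.univ : Finset (Fin d)).card ≤ d := by simp
  -- Transitivity of norms: after multiplication by the denominator, both sides have reciprocal
  -- roots raised to the power `n * m`.
  have hc : cofactor n d (∏ i, (1 - C (α i) * X)) *
      expand A n (cofactor m d (∏ i, (1 - C (α i ^ n) * X))) =
      cofactor (n * m) d (∏ i, (1 - C (α i) * X)) := by
    refine mul_left_cancel₀ (prod_one_sub_ne_zero Finset.univ α) ?_
    rw [← mul_assoc, prod_mul_cofactor hn _ hd, prod_mul_cofactor (Nat.mul_pos hn hm) _ hd,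
      ← map_mul, prod_mul_cofactor hm _ hd, expand_expand]
    simp only [pow_mul]
  rw [landenNum_prod_self hn, landenNum, landenNum, ← contract_mul_expand hn.ne', mul_assoc, hc,
    contract_contract hm hn, landenNum]

lemma exists_prod_one_sub {K : Type*} [Field K] [IsAlgClosed K] {d : ℕ} {q : K[X]}
    (hq : q.natDegree ≤ d) (h0 : q.coeff 0 = 1) :
    ∃ α : Fin d → K, q = ∏ i, (1 - C (α i) * X) := by
  induction d generalizing q with
  | zero =>
    refine ⟨Fin.elim0, ?_⟩
    rw [eq_C_of_natDegree_le_zero hq, h0]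
    simp
  | succ d ih =>
    rcases Nat.eq_zero_or_pos q.natDegree with h | h
    · obtain ⟨α, hα⟩ := ih (h.trans_le (Nat.zero_le d)) h0
      -- A zero entry contributes the factor `1` and pads the product when the degree is smaller
      -- than the bound.
      refine ⟨Fin.cons 0 α, ?_⟩
      rw [Fin.prod_univ_succ, hα]
      simp
    · obtain ⟨x, hx⟩ := IsAlgClosed.exists_root q (degree_pos_of_ne_zero_of_nonunit
        (by rintro rfl; simp at h) fun hu => h.ne' (natDegree_eq_zero_of_isUnit hu)).ne'
      have hx0 : x ≠ 0 := by
        rintro rfl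
        rw [IsRoot, ← coeff_zero_eq_eval_zero, h0] at hx
        exact one_ne_zero hx
      obtain ⟨r, hr⟩ := dvd_iff_isRoot.mpr hx
      have hr' : q = (1 - C x⁻¹ * X) * (C (-x) * r) := by
        have : (X - C x) = C (-x) * (1 - C x⁻¹ * X) := by
          rw [mul_sub, mul_one, ← mul_assoc, ← C_mul, neg_mul, mul_inv_cancel₀ hx0]
          simp only [C_neg, C_1]
          ring
        rw [hr, this]
        ring
      have hr0 : r ≠ 0 := by
        rintro rfl
        rw [mul_zero] at hr
        simp [hr] at h
      have hdeg : (C (-x) * r).natDegree ≤ d := by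
        refine (natDegree_C_mul_le _ _).trans ?_
        rw [hr, natDegree_mul (X_sub_C_ne_zero x) hr0, natDegree_X_sub_C] at hq
        omega
      obtain ⟨α, hα⟩ := ih hdeg (by
        rw [hr', mul_coeff_zero] at h0
        simpa using h0)
      refine ⟨Fin.cons x⁻¹ α, ?_⟩
      rw [Fin.prod_univ_succ, hr', hα]
      simp

lemma natDegree_landenNum_prod_le {m d : ℕ} (hm : 0 < m) {p : A[X]} (hp : p.natDegree ≤ d)
    (α : Fin d → A) : (landenNum m d p (∏ i, (1 - C (α i) * X))).natDegree ≤ d :=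
  natDegree_landenNum_le hm hp (natDegree_cofactor_prod_le hm _ (by simp) α)

/-- The forms record only the coefficients up to `d`. The degree bound for split denominators shows
that nothing is lost, so iterating the forms is iterating `landenNum`. -/
lemma aeval_landenForm_comp_of_isAlgClosed {K : Type*} [Field K] [IsAlgClosed K] {d m n : ℕ}
    (hm : 0 < m) (hn : 0 < n) (v : Fin (d + 1) ⊕ Fin (d + 1) → K) (hv : v (Sum.inr 0) = 1)
    (s : Fin (d + 1) ⊕ Fin (d + 1)) :
    MvPolynomial.aeval (fun j => MvPolynomial.aeval v (landenForm d n j)) (landenForm d m s) =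
      MvPolynomial.aeval v (landenForm d (n * m) s) := by
  obtain ⟨α, hα⟩ := exists_prod_one_sub (natDegree_vecPoly_le (v ∘ Sum.inr))
    ((coeff_zero_vecPoly _).trans hv)
  have hl : vecPoly ((fun j => MvPolynomial.aeval v (landenForm d n j)) ∘ Sum.inl) =
      landenNum n d (vecPoly (v ∘ Sum.inl)) (vecPoly (v ∘ Sum.inr)) := by
    refine Eq.trans ?_ (vecPoly_coeff (d := d) ?_)
    · exact congrArg vecPoly (funext fun i => aeval_landenForm_inl hn v i)
    · rw [hα]
      exact natDegree_landenNum_prod_le hn (natDegree_vecPoly_le _) α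
  have hr : vecPoly ((fun j => MvPolynomial.aeval v (landenForm d n j)) ∘ Sum.inr) =
      landenNum n d (vecPoly (v ∘ Sum.inr)) (vecPoly (v ∘ Sum.inr)) := by
    refine Eq.trans ?_ (vecPoly_coeff (d := d) ?_)
    · exact congrArg vecPoly (funext fun i => aeval_landenForm_inr hn v i)
    · rw [hα]
      exact natDegree_landenNum_prod_le hn ((natDegree_prod_one_sub_le _ _).trans (by simp)) α
  rcases s with i | i
  · rw [aeval_landenForm_inl hm, aeval_landenForm_inl (Nat.mul_pos hn hm), hl, hr, hα,
      landenNum_landenNum_prod hm hn]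
  · rw [aeval_landenForm_inr hm, aeval_landenForm_inr (Nat.mul_pos hn hm), hr, hα,
      landenNum_landenNum_prod hm hn]

/-- The embedding of a domain into the algebraic closure of its fraction field. -/
noncomputable def toAlgClosure (A : Type) [CommRing A] [IsDomain A] :
    A →+* AlgebraicClosure (FractionRing A) :=
  (algebraMap (FractionRing A) (AlgebraicClosure (FractionRing A))).comp
    (algebraMap A (FractionRing A))

lemma toAlgClosure_injective (A : Type) [CommRing A] [IsDomain A] :
    Function.Injective (toAlgClosure A) :=
  (algebraMap (FractionRing A) (AlgebraicClosure (FractionRing A))).injective.comp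
    (IsFractionRing.injective A (FractionRing A))

lemma aeval_landenForm_comp {A : Type} [CommRing A] [IsDomain A] {inst : Algebra ℤ A} {d m n : ℕ}
    (hm : 0 < m) (hn : 0 < n) (v : Fin (d + 1) ⊕ Fin (d + 1) → A) (hv : v (Sum.inr 0) = 1)
    (s : Fin (d + 1) ⊕ Fin (d + 1)) :
    MvPolynomial.aeval (fun j => MvPolynomial.aeval v (landenForm d n j)) (landenForm d m s) =
      MvPolynomial.aeval v (landenForm d (n * m) s) := by
  obtain rfl : inst = Ring.toIntAlgebra A := Subsingleton.elim _ _
  refine toAlgClosure_injective A ?_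
  rw [← aeval_ringHom_comp, ← aeval_ringHom_comp]
  refine Eq.trans ?_ (aeval_landenForm_comp_of_isAlgClosed hm hn (toAlgClosure A ∘ v)
    (by simp [hv]) s)
  congr 2
  exact funext fun j => (aeval_ringHom_comp _ _ _).symm

end Composition

/-! ### Partial fractions and surjectivity on points -/

section Surjectivity

open Polynomial

variable {K : Type*} [Field K] {d : ℕ}

lemma natDegree_prod_erase_le (α : Fin d → K) (i : Fin d) :
    (∏ l ∈ Finset.univ.erase i, (1 - C (α l) * X)).natDegree ≤ d :=
  (natDegree_prod_one_sub_le _ _).trans ((Finset.card_erase_le).trans (by simp))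

lemma eval_prod_one_sub {ι : Type*} (s : Finset ι) (α : ι → K) (x : K) :
    (∏ i ∈ s, (1 - C (α i) * X)).eval x = ∏ i ∈ s, (1 - α i * x) := by
  simp [eval_prod]

lemma eval_inv_prod_one_sub {ι : Type*} {s : Finset ι} {β : ι → K} {i : ι} (hi : i ∈ s)
    (h0 : β i ≠ 0) : (∏ l ∈ s, (1 - C (β l) * X)).eval (β i)⁻¹ = 0 := by
  rw [eval_prod_one_sub]
  exact Finset.prod_eq_zero hi (by rw [mul_inv_cancel₀ h0, sub_self])

/-- Lagrange interpolation for the products obtained from `∏ (1 - β i X)` by omitting at most one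
factor. -/
lemma exists_eq_add_sum_prod_erase {β : Fin d → K} (hβ : Function.Injective β)
    (h0 : ∀ i, β i ≠ 0) {f : K[X]} (hf : f.natDegree ≤ d) :
    ∃ (c : K) (a : Fin d → K), f = C c * ∏ i, (1 - C (β i) * X) +
      ∑ i, C (a i) * ∏ l ∈ Finset.univ.erase i, (1 - C (β l) * X) := by
  -- Interpolation at the `d + 1` points `0` and `(β i)⁻¹`: at `(β i)⁻¹` only the product omitting
  -- `i` survives, and at `0` every product equals `1`, which determines the remaining constant.
  set a : Fin d → K := fun i =>
    f.eval (β i)⁻¹ / (∏ l ∈ Finset.univ.erase i, (1 - C (β l) * X)).eval (β i)⁻¹ with ha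
  refine ⟨f.eval 0 - ∑ i, a i, a, ?_⟩
  have hx : Function.Injective (Fin.cons 0 fun i => (β i)⁻¹ : Fin (d + 1) → K) := by
    rw [Fin.cons_injective_iff]
    refine ⟨?_, inv_injective.comp hβ⟩
    rintro ⟨i, hi⟩
    exact inv_ne_zero (h0 i) hi
  rw [← sub_eq_zero]
  refine eq_zero_of_natDegree_lt_card_of_eval_eq_zero _ hx (fun i => ?_) ?_
  · refine Fin.cases ?_ (fun i => ?_) i
    · simp [eval_finsetSum, eval_prod]
    · have hne : (∏ l ∈ Finset.univ.erase i, (1 - C (β l) * X)).eval (β i)⁻¹ ≠ 0 := by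
        rw [eval_prod_one_sub, Finset.prod_ne_zero_iff]
        intro l hl h
        refine (Finset.mem_erase.mp hl).1 (hβ ?_)
        rw [sub_eq_zero, ← div_eq_mul_inv, eq_div_iff (h0 i), one_mul] at h
        exact h.symm
      rw [Fin.cons_succ, eval_sub, eval_add, eval_mul,
        eval_inv_prod_one_sub (Finset.mem_univ i) (h0 i), mul_zero, zero_add, eval_finsetSum,
        Finset.sum_eq_single i]
      · rw [eval_mul, eval_C, ha]
        simp only
        rw [div_mul_cancel₀ _ hne, sub_self]
      · intro j _ hj
        rw [eval_mul, eval_inv_prod_one_sub (Finset.mem_erase.mpr ⟨hj.symm, Finset.mem_univ i⟩)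
          (h0 i), mul_zero]
      · simp
  · rw [Fintype.card_fin, Nat.lt_succ_iff]
    refine (natDegree_sub_le_of_le hf (natDegree_add_le_of_degree_le
      ((natDegree_C_mul_le _ _).trans ((natDegree_prod_one_sub_le _ _).trans (by simp)))
      (natDegree_sum_le_of_forall_le _ _ fun i _ => (natDegree_C_mul_le _ _).trans
        (natDegree_prod_erase_le β i)))).trans (by simp)

/-- Among the exponents below `m` only `0` is a multiple of `m`. -/
lemma contract_geomSum {A : Type*} [CommRing A] {m : ℕ} (hm : 0 < m) (a : A) :
    contract m (∑ j ∈ Finset.range m, (C a * X) ^ j) = 1 := by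
  ext k
  have h : ∀ j, ((C a * X) ^ j : A[X]).coeff (k * m) = if k * m = j then a ^ j else 0 := by
    intro j
    rw [mul_pow, ← C_pow, coeff_C_mul_X_pow]
  rw [coeff_contract hm.ne', finsetSum_coeff, Finset.sum_congr rfl fun j _ => h j, coeff_one,
    Finset.sum_ite_eq]
  rcases Nat.eq_zero_or_pos k with rfl | hk
  · simp [hm]
  · rw [if_neg, if_neg hk.ne']
    rw [Finset.mem_range, not_lt]
    exact Nat.le_mul_of_pos_left m hk

/-- In terms of fractions, `1 / (1 - α i u)` is sent to `1 / (1 - α i ^ m u)`: the factors other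
than `i` telescope, and the leftover geometric sum contracts to `1`. -/
lemma landenNum_prod_erase {m : ℕ} (hm : 0 < m) (α : Fin d → K) (i : Fin d) :
    landenNum m d (∏ l ∈ Finset.univ.erase i, (1 - C (α l) * X)) (∏ l, (1 - C (α l) * X)) =
      ∏ l ∈ Finset.univ.erase i, (1 - C (α l ^ m) * X) := by
  have h := cofactor_prod hm Finset.univ α
  rw [Finset.card_univ, Fintype.card_fin] at h
  have h1 : (∏ l ∈ Finset.univ.erase i, (1 - C (α l) * X)) *
      (∏ l, ∑ j ∈ Finset.range m, (C (α l) * X) ^ j) =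
      (∑ j ∈ Finset.range m, (C (α i) * X) ^ j) *
        expand K m (∏ l ∈ Finset.univ.erase i, (1 - C (α l ^ m) * X)) := by
    rw [← Finset.mul_prod_erase Finset.univ _ (Finset.mem_univ i), mul_left_comm,
      ← Finset.prod_mul_distrib, map_prod]
    congr 1
    refine Finset.prod_congr rfl fun l _ => ?_
    rw [mul_neg_geom_sum]
    simp [mul_pow]
  rw [landenNum, h, h1, contract_mul_expand hm.ne', contract_geomSum hm, one_mul]

lemma landenNum_add {A : Type*} [CommRing A] {m : ℕ} (hm : 0 < m) (d : ℕ) (p p' q : A[X]) :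
    landenNum m d (p + p') q = landenNum m d p q + landenNum m d p' q := by
  rw [landenNum, add_mul, contract_add hm.ne', landenNum, landenNum]

lemma landenNum_C_mul_left {A : Type*} [CommRing A] {m : ℕ} (hm : 0 < m) (d : ℕ) (c : A)
    (p q : A[X]) : landenNum m d (C c * p) q = C c * landenNum m d p q := by
  ext k
  rw [landenNum, landenNum, coeff_C_mul, coeff_contract hm.ne', coeff_contract hm.ne', mul_assoc,
    coeff_C_mul]

lemma landenNum_sum {A ι : Type*} [CommRing A] {m : ℕ} (hm : 0 < m) (d : ℕ) (s : Finset ι)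
    (p : ι → A[X]) (q : A[X]) :
    landenNum m d (∑ i ∈ s, p i) q = ∑ i ∈ s, landenNum m d (p i) q := by
  ext k
  simp_rw [finsetSum_coeff, landenNum, coeff_contract hm.ne', Finset.sum_mul, finsetSum_coeff]

/-- The map is linear in the numerator, so the preimage has the same partial fraction coefficients,
attached to the poles given by `α` instead of those given by `α ^ m`. -/
lemma exists_landenNum_eq {m : ℕ} (hm : 0 < m) {α : Fin d → K}
    (hα : Function.Injective fun i => α i ^ m) (h0 : ∀ i, α i ≠ 0) {f : K[X]}
    (hf : f.natDegree ≤ d) :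
    ∃ p : K[X], p.natDegree ≤ d ∧ landenNum m d p (∏ i, (1 - C (α i) * X)) = f := by
  obtain ⟨c, a, hca⟩ := exists_eq_add_sum_prod_erase hα (fun i => pow_ne_zero m (h0 i)) hf
  refine ⟨C c * ∏ i, (1 - C (α i) * X) +
    ∑ i, C (a i) * ∏ l ∈ Finset.univ.erase i, (1 - C (α l) * X), ?_, ?_⟩
  · exact natDegree_add_le_of_degree_le
      ((natDegree_C_mul_le _ _).trans ((natDegree_prod_one_sub_le _ _).trans (by simp)))
      (natDegree_sum_le_of_forall_le _ _ fun i _ => (natDegree_C_mul_le _ _).trans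
        (natDegree_prod_erase_le α i))
  · rw [landenNum_add hm, landenNum_C_mul_left hm, landenNum_prod_self hm, landenNum_sum hm, hca]
    congr 1
    refine Finset.sum_congr rfl fun i _ => ?_
    rw [landenNum_C_mul_left hm, landenNum_prod_erase hm]

/-- That the preimage has the same `a₀` as the target is recorded so that targets with `a₀ = 0` lift
within that locus. -/
lemma exists_aeval_landenForm_eq [IsAlgClosed K] {m : ℕ} (hm : 0 < m) (c : Fin (d + 1) → K)
    {β : Fin d → K} (hβ : Function.Injective β) (h0 : ∀ i, β i ≠ 0) :
    ∃ v : Fin (d + 1) ⊕ Fin (d + 1) → K, v (Sum.inl 0) = c 0 ∧ v (Sum.inr 0) = 1 ∧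
      (∀ i, MvPolynomial.aeval v (landenForm d m (Sum.inl i)) = c i) ∧
      ∀ i, MvPolynomial.aeval v (landenForm d m (Sum.inr i)) =
        (∏ l, (1 - C (β l) * X)).coeff i := by
  choose α hα using fun i => IsAlgClosed.exists_pow_nat_eq (β i) hm
  have hα0 : ∀ i, α i ≠ 0 := fun i h => h0 i (by rw [← hα, h, zero_pow hm.ne'])
  obtain ⟨p, hp, hpc⟩ := exists_landenNum_eq hm (α := α) (by simpa only [hα] using hβ) hα0
    (natDegree_vecPoly_le c)
  have hq : (∏ i, (1 - C (α i) * X)).natDegree ≤ d :=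
    (natDegree_prod_one_sub_le _ _).trans (by simp)
  have hq0 : (∏ i, (1 - C (α i) * X)).coeff 0 = 1 := by
    rw [coeff_zero_eq_eval_zero, eval_prod_one_sub]
    simp
  refine ⟨Sum.elim (fun i => p.coeff i) (fun i => (∏ i, (1 - C (α i) * X)).coeff i), ?_, ?_,
    fun i => ?_, fun i => ?_⟩
  · have := congrArg (fun f => f.coeff 0) hpc
    simp only [coeff_zero_landenNum hm, hq0, one_pow, mul_one, coeff_zero_vecPoly] at this
    exact this
  · exact hq0
  · rw [aeval_landenForm_inl hm, Sum.elim_comp_inl, Sum.elim_comp_inr, vecPoly_coeff hp,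
      vecPoly_coeff hq, hpc, coeff_vecPoly]
  · rw [aeval_landenForm_inr hm, Sum.elim_comp_inr, vecPoly_coeff hq, landenNum_prod_self hm]
    simp only [hα]

end Surjectivity

/-! ### From surjectivity to algebraic independence -/

section Independence

open Polynomial

/-- The coordinates of a vector and the elementary symmetric functions of another one. -/
noncomputable def symmCoord (ι K : Type) [CommRing K] (d : ℕ) :
    ι ⊕ Fin d → MvPolynomial (ι ⊕ Fin d) K :=
  Sum.elim (fun i => MvPolynomial.X (Sum.inl i))
    fun j => (∏ i, (1 - C (MvPolynomial.X (Sum.inr i)) * X) :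
      (MvPolynomial (ι ⊕ Fin d) K)[X]).coeff (j + 1)

lemma aeval_symmCoord {ι K : Type} [CommRing K] {d : ℕ} (c : ι → K) (β : Fin d → K)
    (t : ι ⊕ Fin d) :
    MvPolynomial.aeval (Sum.elim c β) (symmCoord ι K d t) =
      Sum.elim c (fun j => (∏ i, (1 - C (β i) * X)).coeff (j + 1)) t := by
  rcases t with i | j
  · simp [symmCoord]
  · have h := coeff_map (MvPolynomial.aeval (R := K) (Sum.elim c β)).toRingHom
      (p := ∏ i : Fin d, (1 - C (MvPolynomial.X (Sum.inr i)) * X)) (j + 1)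
    refine h.symm.trans ?_
    simp [Polynomial.map_prod]

/-- A relation among the `e t` vanishes at every target reached. Written in the reciprocal roots it
vanishes wherever these are distinct and nonzero, hence identically; and every coefficient vector
comes from some reciprocal roots. -/
lemma algebraicIndependent_of_surjective {ι K : Type} [Field K] [IsAlgClosed K] {d : ℕ}
    (e : ι ⊕ Fin d → MvPolynomial (ι ⊕ Fin d) K)
    (h : ∀ (c : ι → K) (β : Fin d → K), Function.Injective β → (∀ i, β i ≠ 0) →
      ∃ x : ι ⊕ Fin d → K, ∀ t, MvPolynomial.aeval x (e t) =
        Sum.elim c (fun j => (∏ i, (1 - C (β i) * X)).coeff (j + 1)) t) :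
    AlgebraicIndependent K e := by
  rw [algebraicIndependent_iff]
  intro P hP
  have : Infinite K := IsAlgClosed.instInfinite
  -- `D` vanishes exactly where `β` has a zero or repeated entry, so the product with `D` vanishes
  -- at every point.
  set D : MvPolynomial (ι ⊕ Fin d) K := (∏ i, MvPolynomial.X (Sum.inr i)) *
    ∏ i, ∏ j ∈ Finset.univ.erase i, (MvPolynomial.X (Sum.inr i) - MvPolynomial.X (Sum.inr j))
    with hD
  have hD0 : D ≠ 0 := by
    refine mul_ne_zero (Finset.prod_ne_zero_iff.mpr fun i _ => MvPolynomial.X_ne_zero _)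
      (Finset.prod_ne_zero_iff.mpr fun i _ => Finset.prod_ne_zero_iff.mpr fun j hj => ?_)
    rw [sub_ne_zero]
    intro hij
    have := Sum.inr_injective (MvPolynomial.X_injective hij)
    exact (Finset.mem_erase.mp hj).1 this.symm
  have h1 : MvPolynomial.aeval (symmCoord ι K d) P * D = 0 := by
    refine MvPolynomial.funext fun y => ?_
    obtain ⟨c, β, rfl⟩ : ∃ c β, y = Sum.elim c β := ⟨_, _, (Sum.elim_comp_inl_inr y).symm⟩
    rw [← MvPolynomial.aeval_eq_eval, map_zero, map_mul]
    by_cases hβ : Function.Injective β ∧ ∀ i, β i ≠ 0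
    · obtain ⟨x, hx⟩ := h c β hβ.1 hβ.2
      have h2 : MvPolynomial.aeval (Sum.elim c β) (MvPolynomial.aeval (symmCoord ι K d) P) =
          MvPolynomial.aeval x (MvPolynomial.aeval e P) := by
        rw [MvPolynomial.comp_aeval_apply, MvPolynomial.comp_aeval_apply]
        simp only [aeval_symmCoord, hx]
      rw [h2, hP, map_zero, zero_mul]
    · convert mul_zero _
      rw [not_and_or] at hβ
      rw [hD, map_mul, map_prod, map_prod]
      rcases hβ with hβ | hβ
      · convert mul_zero _
        simp only [Function.Injective, not_forall] at hβ
        obtain ⟨i, j, hij, hne⟩ := hβ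
        refine Finset.prod_eq_zero (Finset.mem_univ i) ?_
        rw [map_prod]
        refine Finset.prod_eq_zero
          (Finset.mem_erase.mpr ⟨fun h => hne h.symm, Finset.mem_univ j⟩) ?_
        simp [hij]
      · convert zero_mul _
        simp only [not_forall, not_not] at hβ
        obtain ⟨i, hi⟩ := hβ
        exact Finset.prod_eq_zero (Finset.mem_univ i) (by simp [hi])
  have h2 := (mul_eq_zero.mp h1).resolve_right hD0
  refine MvPolynomial.funext fun y => ?_
  -- The polynomial with constant term `1` and remaining coefficients `y` splits, so `y` is a value
  -- of `symmCoord`.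
  have hdeg : (1 + X * ∑ j : Fin d, C (y (Sum.inr j)) * X ^ (j : ℕ)).natDegree ≤ d := by
    refine natDegree_add_le_of_degree_le (by simp) ?_
    rw [Finset.mul_sum]
    refine natDegree_sum_le_of_forall_le _ _ fun j _ => ?_
    rw [mul_left_comm, ← pow_succ']
    exact (natDegree_C_mul_X_pow_le _ _).trans j.2
  obtain ⟨α, hα⟩ := exists_prod_one_sub hdeg (by simp)
  have h3 : ∀ t, MvPolynomial.aeval (Sum.elim (y ∘ Sum.inl) α) (symmCoord ι K d t) = y t := by
    intro t
    rw [aeval_symmCoord, ← hα]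
    rcases t with i | j
    · rfl
    · simp only [Sum.elim_inr, coeff_add, coeff_one, coeff_X_mul]
      rw [if_neg (Nat.succ_ne_zero _), zero_add, finsetSum_coeff, Finset.sum_eq_single j]
      · simp
      · intro l _ hl
        rw [coeff_C_mul_X_pow, if_neg fun h => hl (Fin.ext h).symm]
      · simp
  have h4 := congrArg (MvPolynomial.aeval (Sum.elim (y ∘ Sum.inl) α)) h2
  rw [MvPolynomial.comp_aeval_apply, map_zero] at h4
  simp only [h3] at h4
  rw [← MvPolynomial.aeval_eq_eval, map_zero]
  exact h4

lemma aeval_map_reduction {τ K : Type} [CommRing K] {s : Spec (.of ℤ)} (φ : ℤ ⧸ s.asIdeal →+* K)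
    (x : τ → K) (p : MvPolynomial τ ℤ) :
    MvPolynomial.aeval x (MvPolynomial.map φ (reduction τ s p)) = MvPolynomial.aeval x p :=
  RingHom.congr_fun (MvPolynomial.ringHom_ext (f := (MvPolynomial.aeval x).toRingHom.comp
    ((MvPolynomial.map φ).comp (reduction _ s))) (g := (MvPolynomial.aeval x).toRingHom)
    (fun r => by simp) (fun i => by simp [reduction])) p

/-- Independence is proved over an algebraic closure of the residue field at `s` and descends along
the injection of `ℤ ⧸ s`. -/
lemma independentOnFibres_of_surjective {ι : Type} {d : ℕ}
    (e : ι ⊕ Fin d → MvPolynomial (ι ⊕ Fin d) ℤ)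
    (h : ∀ (K : Type) [Field K] [IsAlgClosed K] (c : ι → K) (β : Fin d → K),
      Function.Injective β → (∀ i, β i ≠ 0) → ∃ x : ι ⊕ Fin d → K, ∀ t,
        MvPolynomial.aeval x (e t) =
          Sum.elim c (fun j => (∏ i, (1 - C (β i) * X)).coeff (j + 1)) t) :
    IndependentOnFibres e := by
  intro s
  obtain ⟨K, _, _, φ, hφ⟩ : ∃ (K : Type) (_ : Field K) (_ : IsAlgClosed K)
      (φ : ℤ ⧸ s.asIdeal →+* K), Function.Injective φ :=
    ⟨_, _, inferInstance, _, toAlgClosure_injective _⟩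
  have h1 : AlgebraicIndependent K fun t => MvPolynomial.map φ (reduction _ s (e t)) := by
    refine algebraicIndependent_of_surjective _ fun c β hβ h0 => ?_
    obtain ⟨x, hx⟩ := h K c β hβ h0
    refine ⟨x, fun t => Eq.trans ?_ (hx t)⟩
    exact aeval_map_reduction φ x (e t)
  rw [algebraicIndependent_iff] at h1 ⊢
  intro P hP
  refine MvPolynomial.map_injective φ hφ ?_
  rw [map_zero]
  refine h1 _ ?_
  have := congrArg (MvPolynomial.map φ) hP
  rw [map_zero] at this
  rw [← this]
  exact RingHom.congr_fun (MvPolynomial.ringHom_ext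
    (f := (MvPolynomial.aeval fun t => MvPolynomial.map φ (reduction _ s (e t))).toRingHom.comp
      (MvPolynomial.map φ))
    (g := (MvPolynomial.map φ).comp (MvPolynomial.aeval fun t => reduction _ s (e t)).toRingHom)
    (fun r => by simp) (fun i => by simp)) P

end Independence

section Evaluation

/-! The `ℤ`-algebra structures are arbitrary here, since those on polynomial rings are not
syntactically the ones derived from the ring structure. -/

lemma ringHom_aeval {σ A B : Type} [CommRing A] [CommRing B] {_ : Algebra ℤ A} {_ : Algebra ℤ B}
    (φ : A →+* B) (v : σ → A) (f : MvPolynomial σ ℤ) :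
    φ (MvPolynomial.aeval v f) = MvPolynomial.aeval (φ ∘ v) f := by
  have h : φ.comp (MvPolynomial.aeval v : MvPolynomial σ ℤ →ₐ[ℤ] A).toRingHom =
      (MvPolynomial.aeval (φ ∘ v) : MvPolynomial σ ℤ →ₐ[ℤ] B).toRingHom :=
    MvPolynomial.ringHom_ext (fun r => by simp) (fun i => by simp)
  exact RingHom.congr_fun h f

lemma aeval_aeval {σ τ A : Type} [CommRing A] {_ : Algebra ℤ A} (x : τ → A) (w : σ → MvPolynomial τ ℤ)
    (f : MvPolynomial σ ℤ) :
    MvPolynomial.aeval x (MvPolynomial.aeval w f) =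
      MvPolynomial.aeval (fun s => MvPolynomial.aeval x (w s)) f :=
  ringHom_aeval (MvPolynomial.aeval x).toRingHom w f

end Evaluation

/-! ### Field-valued generic points and independence of the chart -/

section GenericPoint

attribute [local instance] MvPolynomial.gradedAlgebra

variable {σ τ : Type} {i : σ} {j : τ → σ} {v : σ → MvPolynomial τ ℤ}

lemma isDominant_point (hi : v i = 1) (hj : ∀ t, v (j t) = MvPolynomial.X t)
    (hs : ∀ s, s = i ∨ ∃ t, j t = s) (hv : Ideal.span (Set.range v) = ⊤) :
    IsDominant (point v hv) := by
  have : Nonempty σ := ⟨i⟩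
  refine ⟨?_⟩
  rw [DenseRange, (isOpenImmersion_point hi hj hs).2]
  exact dense_formOpen (MvPolynomial.X_ne_zero i)

lemma isDominant_Spec_map {A B : Type} [CommRing A] [CommRing B] (φ : A →+* B)
    (hφ : Function.Injective φ) : IsDominant (Spec.map (CommRingCat.ofHom φ)) := by
  refine ⟨?_⟩
  refine (PrimeSpectrum.denseRange_comap_iff_ker_le_nilRadical φ).mpr ?_
  rw [(RingHom.injective_iff_ker_eq_bot φ).mp hφ]
  exact bot_le

/-- With `B` a field this gives a dominant field-valued point, the kind of point on which a Landen
map is prescribed. -/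
lemma isDominant_point_comp (hi : v i = 1) (hj : ∀ t, v (j t) = MvPolynomial.X t)
    (hs : ∀ s, s = i ∨ ∃ t, j t = s) {B : Type} [CommRing B] (φ : MvPolynomial τ ℤ →+* B)
    (hφ : Function.Injective φ) (hv : Ideal.span (Set.range (φ ∘ v)) = ⊤) :
    IsDominant (point (φ ∘ v) hv) := by
  have h1 := Spec_map_point φ v (span_eq_top_of_one v i hi) (f := MvPolynomial.X i)
    (by rw [MvPolynomial.aeval_X, hi]; exact isUnit_one) one_pos (MvPolynomial.isHomogeneous_X ℤ i)
  have := isDominant_Spec_map φ hφ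
  have := isDominant_point hi hj hs (span_eq_top_of_one v i hi)
  rw [← h1]
  infer_instance

lemma span_range_eq_top_of_ne_zero {K : Type} [Field K] {w : σ → K} {i : σ} (h : w i ≠ 0) :
    Ideal.span (Set.range w) = ⊤ :=
  Ideal.eq_top_of_isUnit_mem _ (Ideal.subset_span ⟨i, rfl⟩) h.isUnit

lemma exists_ne_zero_of_span_range {K : Type} [Field K] {w : σ → K}
    (h : Ideal.span (Set.range w) = ⊤) : ∃ i, w i ≠ 0 := by
  by_contra! hw
  have : w = 0 := funext hw
  rw [this, Ideal.eq_top_iff_one] at h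
  have h1 : Ideal.span (Set.range (0 : σ → K)) ≤ ⊥ := by
    rw [Ideal.span_le]
    rintro _ ⟨k, rfl⟩
    rfl
  exact one_ne_zero (Ideal.mem_bot.mp (h1 h))

/-- Both forms are nonzero at the generic point, where the two descriptions give the same
homogeneous coordinates. -/
lemma formMap_toRationalMap_eq (hi : v i = 1) (hj : ∀ t, v (j t) = MvPolynomial.X t)
    (hs : ∀ s, s = i ∨ ∃ t, j t = s) [Nonempty σ] {F : σ → MvPolynomial σ ℤ} {m : ℕ} (hm : 0 < m)
    (hF : ∀ k, (F k).IsHomogeneous m) {k l : σ} (hk : F k ≠ 0) (hl : F l ≠ 0) :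
    (formMap hm hF k hk).toRationalMap = (formMap hm hF l hl).toRationalMap := by
  obtain ⟨K, _, φ, hφ⟩ : ∃ (K : Type) (_ : Field K) (φ : MvPolynomial τ ℤ →+* K),
      Function.Injective φ :=
    ⟨_, _, algebraMap _ (FractionRing (MvPolynomial τ ℤ)), IsFractionRing.injective _ _⟩
  have h1 : ∀ s, F s ≠ 0 → MvPolynomial.aeval (φ ∘ v) (F s) ≠ 0 := by
    intro s h h0
    refine h (eq_zero_of_aeval_eq_zero hi hj hs (hF s) (hφ ?_))
    rw [map_zero, ← h0, ringHom_aeval]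
  have := isDominant_point_comp hi hj hs φ hφ
    (span_range_comp φ v (span_eq_top_of_one v i hi))
  exact eq_of_sends _ (sends_formMap hm hF k hk _ _ (h1 k hk).isUnit
    (span_range_eq_top_of_ne_zero (h1 k hk))) (sends_formMap hm hF l hl _ _ (h1 l hl).isUnit _)

lemma sends_formMap_of_field (hi : v i = 1) (hj : ∀ t, v (j t) = MvPolynomial.X t)
    (hs : ∀ s, s = i ∨ ∃ t, j t = s) [Nonempty σ] {F : σ → MvPolynomial σ ℤ} {m : ℕ} (hm : 0 < m)
    (hF : ∀ k, (F k).IsHomogeneous m) {k : σ} (hk : F k ≠ 0) {K : Type} [Field K] (w : σ → K)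
    (hw : Ideal.span (Set.range w) = ⊤)
    (hFw : Ideal.span (Set.range fun l => MvPolynomial.aeval w (F l)) = ⊤) :
    Sends (formMap hm hF k hk).toRationalMap (point w hw)
      (point (fun l => MvPolynomial.aeval w (F l)) hFw) := by
  obtain ⟨l, hl⟩ := exists_ne_zero_of_span_range hFw
  have hl0 : F l ≠ 0 := fun h => hl (by rw [h, map_zero])
  rw [formMap_toRationalMap_eq hi hj hs hm hF hk hl0]
  exact sends_formMap hm hF l hl0 w hw hl.isUnit hFw

end GenericPoint

/-! ### The rational map and its restriction to stable affine loci -/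

section LandenMap

attribute [local instance] MvPolynomial.gradedAlgebra

variable {d m n : ℕ}

lemma landenForm_inr_zero_ne_zero (hm : 0 < m) : landenForm d m (Sum.inr 0) ≠ 0 := by
  rw [landenForm_inr_zero hm]
  exact pow_ne_zero m (MvPolynomial.X_ne_zero _)

/-- The rational self-map of projective space given by the forms `landenForm d m`. -/
noncomputable def landenMap (d m : ℕ) (hm : 0 < m) : PP d ⤏ PP d :=
  (formMap hm (isHomogeneous_landenForm hm) (Sum.inr 0)
    (landenForm_inr_zero_ne_zero (d := d) hm)).toRationalMap

variable {τ : Type} {j : τ → Fin (d + 1) ⊕ Fin (d + 1)}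
  {v : Fin (d + 1) ⊕ Fin (d + 1) → MvPolynomial τ ℤ}

/-- The coordinate polynomials of the endomorphism induced on an affine chart. -/
noncomputable def chartForm (v : Fin (d + 1) ⊕ Fin (d + 1) → MvPolynomial τ ℤ)
    (j : τ → Fin (d + 1) ⊕ Fin (d + 1)) (m : ℕ) (t : τ) : MvPolynomial τ ℤ :=
  MvPolynomial.aeval v (landenForm d m (j t))

lemma polyMap_chartForm_comm (hv : v (Sum.inr 0) = 1)
    (hcl : ∀ m, 0 < m → ∀ s, MvPolynomial.aeval (chartForm v j m) (v s) =
      MvPolynomial.aeval v (landenForm d m s)) (hm : 0 < m) (hn : 0 < n) :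
    polyMap (chartForm v j m) ≫ polyMap (chartForm v j n) =
      polyMap (chartForm v j n) ≫ polyMap (chartForm v j m) := by
  -- By stability of the locus (`hcl`) each composite is the map of index `m * n`, which is
  -- symmetric in the two.
  have key : ∀ m n, 0 < m → 0 < n → ∀ t, MvPolynomial.aeval (chartForm v j m) (chartForm v j n t) =
      MvPolynomial.aeval v (landenForm d (m * n) (j t)) := by
    intro m n hm hn t
    rw [chartForm, aeval_aeval, funext (hcl m hm)]
    exact aeval_landenForm_comp hn hm v hv (j t)
  rw [polyMap, polyMap, ← Spec.map_comp, ← Spec.map_comp]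
  refine congrArg (fun φ : MvPolynomial τ ℤ →+* MvPolynomial τ ℤ => Spec.map (CommRingCat.ofHom φ))
    (a₁ := (MvPolynomial.aeval (chartForm v j m)).toRingHom.comp
      (MvPolynomial.aeval (chartForm v j n)).toRingHom)
    (a₂ := (MvPolynomial.aeval (chartForm v j n)).toRingHom.comp
      (MvPolynomial.aeval (chartForm v j m)).toRingHom) ?_
  refine MvPolynomial.ringHom_ext (fun r => by simp) fun t => ?_
  have h := (key m n hm hn t).trans ((congrArg (fun k => MvPolynomial.aeval v
    (landenForm d k (j t))) (mul_comm m n)).trans (key n m hn hm t).symm)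
  simpa using h

lemma sends_landenMap (hv : v (Sum.inr 0) = 1)
    (hcl : ∀ s, MvPolynomial.aeval (chartForm v j m) (v s) =
      MvPolynomial.aeval v (landenForm d m s)) (hm : 0 < m)
    (hv' : Ideal.span (Set.range v) = ⊤) :
    Sends (landenMap d m hm) (point v hv') (polyMap (chartForm v j m) ≫ point v hv') := by
  have hu : MvPolynomial.aeval v (landenForm d m (Sum.inr 0)) = 1 := by
    rw [landenForm_inr_zero hm, map_pow, MvPolynomial.aeval_X, hv, one_pow]
  have h1 := sends_formMap hm (isHomogeneous_landenForm hm) (Sum.inr 0)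
    (landenForm_inr_zero_ne_zero (d := d) hm) v hv' (hu ▸ isUnit_one)
    (span_eq_top_of_one _ (Sum.inr 0) hu)
  have h2 := Spec_map_point (MvPolynomial.aeval (R := ℤ) (chartForm v j m)).toRingHom v hv'
    (f := MvPolynomial.X (Sum.inr 0)) (by rw [MvPolynomial.aeval_X, hv]; exact isUnit_one) one_pos
    (MvPolynomial.isHomogeneous_X ℤ _)
  rw [polyMap, h2, landenMap]
  convert h1 using 2
  exact funext hcl

end LandenMap

/-! ### The chart `b₀ = 1` and the slice `a₀ = 0` -/

section Charts

variable {d m n : ℕ}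

/-- The homogeneous coordinates of the generic point of the chart `b₀ = 1`. -/
noncomputable def chartVec (d : ℕ) :
    Fin (d + 1) ⊕ Fin (d + 1) → MvPolynomial (Fin (d + 1) ⊕ Fin d) ℤ :=
  Sum.elim (fun i => MvPolynomial.X (Sum.inl i)) (Fin.cons 1 fun i => MvPolynomial.X (Sum.inr i))

/-- The homogeneous coordinates of the generic point of the locus `a₀ = 0`, `b₀ = 1`. -/
noncomputable def sliceVec (d : ℕ) :
    Fin (d + 1) ⊕ Fin (d + 1) → MvPolynomial (Fin d ⊕ Fin d) ℤ :=
  Sum.elim (Fin.cons 0 fun i => MvPolynomial.X (Sum.inl i))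
    (Fin.cons 1 fun i => MvPolynomial.X (Sum.inr i))

/-- The homogeneous coordinate that corresponds to a coordinate of the chart. -/
def chartIdx (d : ℕ) : Fin (d + 1) ⊕ Fin d → Fin (d + 1) ⊕ Fin (d + 1) := Sum.map id Fin.succ

/-- The homogeneous coordinate that corresponds to a coordinate of the slice. -/
def sliceIdx (d : ℕ) : Fin d ⊕ Fin d → Fin (d + 1) ⊕ Fin (d + 1) := Sum.map Fin.succ Fin.succ

lemma chartVec_inr_zero : chartVec d (Sum.inr 0) = 1 := rfl

lemma sliceVec_inr_zero : sliceVec d (Sum.inr 0) = 1 := rfl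

lemma chartVec_chartIdx (t : Fin (d + 1) ⊕ Fin d) :
    chartVec d (chartIdx d t) = MvPolynomial.X t := by
  rcases t with i | i <;> rfl

lemma sliceVec_sliceIdx (t : Fin d ⊕ Fin d) :
    sliceVec d (sliceIdx d t) = MvPolynomial.X t := by
  rcases t with i | i <;> rfl

lemma eq_or_exists_chartIdx (s : Fin (d + 1) ⊕ Fin (d + 1)) :
    s = Sum.inr 0 ∨ ∃ t, chartIdx d t = s := by
  rcases s with i | i
  · exact Or.inr ⟨Sum.inl i, rfl⟩
  · refine Fin.cases (Or.inl rfl) (fun i => Or.inr ⟨Sum.inr i, rfl⟩) i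

lemma aeval_landenForm_inr_zero {A : Type} [CommRing A] {_ : Algebra ℤ A} (hm : 0 < m)
    {v : Fin (d + 1) ⊕ Fin (d + 1) → A} (hv : v (Sum.inr 0) = 1) :
    MvPolynomial.aeval v (landenForm d m (Sum.inr 0)) = 1 := by
  rw [landenForm_inr_zero hm, map_pow, MvPolynomial.aeval_X, hv, one_pow]

lemma aeval_chartForm_chartVec (hm : 0 < m) (s : Fin (d + 1) ⊕ Fin (d + 1)) :
    MvPolynomial.aeval (chartForm (chartVec d) (chartIdx d) m) (chartVec d s) =
      MvPolynomial.aeval (chartVec d) (landenForm d m s) := by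
  rcases eq_or_exists_chartIdx s with rfl | ⟨t, rfl⟩
  · rw [aeval_landenForm_inr_zero hm chartVec_inr_zero, chartVec_inr_zero, map_one]
  · rw [chartVec_chartIdx, MvPolynomial.aeval_X, chartForm]

lemma aeval_chartForm_sliceVec (hm : 0 < m) (s : Fin (d + 1) ⊕ Fin (d + 1)) :
    MvPolynomial.aeval (chartForm (sliceVec d) (sliceIdx d) m) (sliceVec d s) =
      MvPolynomial.aeval (sliceVec d) (landenForm d m s) := by
  have h : (s = Sum.inl 0 ∨ s = Sum.inr 0) ∨ ∃ t, sliceIdx d t = s := by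
    rcases s with i | i
    · exact Fin.cases (Or.inl (Or.inl rfl)) (fun i => Or.inr ⟨Sum.inl i, rfl⟩) i
    · exact Fin.cases (Or.inl (Or.inr rfl)) (fun i => Or.inr ⟨Sum.inr i, rfl⟩) i
  rcases h with (rfl | rfl) | ⟨t, rfl⟩
  · rw [landenForm_inl_zero hm, map_mul, MvPolynomial.aeval_X,
      show sliceVec d (Sum.inl 0) = 0 from rfl, map_zero, zero_mul]
  · rw [aeval_landenForm_inr_zero hm sliceVec_inr_zero, sliceVec_inr_zero, map_one]
  · rw [sliceVec_sliceIdx, MvPolynomial.aeval_X, chartForm]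

lemma independentOnFibres_chartForm_chartVec (hm : 0 < m) :
    IndependentOnFibres (chartForm (chartVec d) (chartIdx d) m) := by
  refine independentOnFibres_of_surjective _ fun K _ _ c β hβ h0 => ?_
  obtain ⟨v, -, hv1, hva, hvb⟩ := exists_aeval_landenForm_eq hm c hβ h0
  refine ⟨v ∘ chartIdx d, fun t => ?_⟩
  have h1 : (fun s => MvPolynomial.aeval (v ∘ chartIdx d) (chartVec d s)) = v := by
    funext s
    rcases eq_or_exists_chartIdx s with rfl | ⟨t, rfl⟩
    · rw [chartVec_inr_zero, map_one, hv1]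
    · rw [chartVec_chartIdx, MvPolynomial.aeval_X, Function.comp_apply]
  rw [chartForm, aeval_aeval, h1]
  rcases t with i | i
  · exact hva i
  · exact hvb i.succ

lemma independentOnFibres_chartForm_sliceVec (hm : 0 < m) :
    IndependentOnFibres (chartForm (sliceVec d) (sliceIdx d) m) := by
  refine independentOnFibres_of_surjective _ fun K _ _ c β hβ h0 => ?_
  -- The target is taken with `a₀ = 0`; its preimage then also has `a₀ = 0` and is a point of the
  -- slice.
  obtain ⟨v, hv0, hv1, hva, hvb⟩ := exists_aeval_landenForm_eq hm (Fin.cons 0 c) hβ h0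
  refine ⟨v ∘ sliceIdx d, fun t => ?_⟩
  have h1 : (fun s => MvPolynomial.aeval (v ∘ sliceIdx d) (sliceVec d s)) = v := by
    funext s
    rcases s with i | i
    · refine Fin.cases ?_ (fun i => ?_) i
      · exact (map_zero _).trans hv0.symm
      · exact MvPolynomial.aeval_X _ _
    · refine Fin.cases ?_ (fun i => ?_) i
      · exact (map_one _).trans hv1.symm
      · exact MvPolynomial.aeval_X _ _
  rw [chartForm, aeval_aeval, h1]
  rcases t with i | i
  · exact hva i.succ
  · exact hvb i.succ

end Charts

/-! ### Averaging over roots of unity -/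

section RootsOfUnity

open Polynomial

variable {L : Type*} [Field L] {m d : ℕ} {ξ : L}

lemma sum_comp_root_of_unity (hm : 0 < m) (hξ : IsPrimitiveRoot ξ m) (f : L[X]) :
    ∑ t ∈ Finset.range m, f.comp (C (ξ ^ t) * X) = C (m : L) * expand L m (contract m f) := by
  ext k
  rw [finsetSum_coeff, coeff_C_mul, coeff_expand hm]
  simp only [comp_C_mul_X_coeff]
  rw [← Finset.mul_sum]
  by_cases hk : m ∣ k
  · rw [if_pos hk, coeff_contract hm.ne', Nat.div_mul_cancel hk,
      Finset.sum_congr rfl fun t _ => show (ξ ^ t) ^ k = 1 from by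
        rw [← pow_mul, mul_comm, pow_mul, (hξ.pow_eq_one_iff_dvd k).mpr hk, one_pow]]
    simp [mul_comm]
  · have h1 : ξ ^ k ≠ 1 := fun h => hk ((hξ.pow_eq_one_iff_dvd k).mp h)
    have h2 : (∑ t ∈ Finset.range m, (ξ ^ t) ^ k) * (ξ ^ k - 1) = 0 := by
      rw [Finset.sum_congr rfl fun t _ => show (ξ ^ t) ^ k = (ξ ^ k) ^ t from by
        rw [← pow_mul, mul_comm, pow_mul], geom_sum_mul, ← pow_mul, mul_comm, pow_mul,
        hξ.pow_eq_one, one_pow, sub_self]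
    rw [if_neg hk, (mul_eq_zero.mp h2).resolve_right (sub_ne_zero.mpr h1), mul_zero, mul_zero]

lemma mul_cofactor_eq_prod (hm : 0 < m) (hξ : IsPrimitiveRoot ξ m) {q : L[X]}
    (hq : q.natDegree ≤ d) :
    q * cofactor m d q = ∏ i ∈ Finset.range m, q.comp (C (ξ ^ i) * X) := by
  obtain ⟨k, rfl⟩ := Nat.exists_eq_add_of_le' hm
  rw [cofactor_eq_prod hm hξ hq, Finset.prod_range_succ', Nat.add_sub_cancel, mul_comm]
  simp

/-- Rotation by `ξ` permutes the factors of the norm cyclically. -/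
lemma mul_cofactor_comp (hm : 0 < m) (hξ : IsPrimitiveRoot ξ m) {q : L[X]}
    (hq : q.natDegree ≤ d) (t : ℕ) :
    (q * cofactor m d q).comp (C (ξ ^ t) * X) = q * cofactor m d q := by
  induction t with
  | zero => simp
  | succ t ih =>
    have h1 : (q * cofactor m d q).comp (C ξ * X) = q * cofactor m d q := by
      rw [mul_cofactor_eq_prod hm hξ hq, Polynomial.prod_comp]
      have h2 : ∀ i, (q.comp (C (ξ ^ i) * X)).comp (C ξ * X) = q.comp (C (ξ ^ (i + 1)) * X) := by
        intro i
        rw [comp_assoc, mul_comp, C_comp, X_comp, ← mul_assoc, ← C_mul, pow_succ]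
      rw [Finset.prod_congr rfl fun i _ => h2 i]
      obtain ⟨k, rfl⟩ := Nat.exists_eq_add_of_le' hm
      rw [Finset.prod_range_succ, Finset.prod_range_succ', hξ.pow_eq_one, pow_zero]
    have h3 : (C (ξ ^ (t + 1)) * X : L[X]) = (C (ξ ^ t) * X).comp (C ξ * X) := by
      rw [mul_comp, C_comp, X_comp, ← mul_assoc, ← C_mul, pow_succ]
    rw [h3, ← comp_assoc, ih, h1]

/-- A rotation-invariant polynomial equals its own average, which is a polynomial in `X ^ m`. -/
lemma mul_cofactor_eq_expand (hm : (m : L) ≠ 0) (hξ : IsPrimitiveRoot ξ m) {q : L[X]}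
    (hq : q.natDegree ≤ d) : q * cofactor m d q = expand L m (landenNum m d q q) := by
  have hm' : 0 < m := Nat.pos_of_ne_zero (by rintro rfl; simp at hm)
  have h := sum_comp_root_of_unity hm' hξ (q * cofactor m d q)
  rw [Finset.sum_congr rfl fun t _ => mul_cofactor_comp hm' hξ hq t, Finset.sum_const,
    Finset.card_range, nsmul_eq_mul, ← C_eq_natCast] at h
  exact mul_left_cancel₀ (C_ne_zero.mpr hm) h

lemma natDegree_cofactor_le (hm : 0 < m) (hξ : IsPrimitiveRoot ξ m) {q : L[X]}
    (hq : q.natDegree ≤ d) : (cofactor m d q).natDegree ≤ d * (m - 1) := by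
  rw [cofactor_eq_prod hm hξ hq]
  refine (natDegree_prod_le _ _).trans ((Finset.sum_le_card_nsmul _ _ d fun i _ => ?_).trans
    (by simp [mul_comm]))
  refine natDegree_comp_le.trans ?_
  calc q.natDegree * (C (ξ ^ (i + 1)) * X).natDegree ≤ d * 1 :=
        Nat.mul_le_mul hq ((natDegree_C_mul_le _ _).trans natDegree_X_le)
    _ = d := mul_one d

lemma landenNum_self_ne_zero (hm : (m : L) ≠ 0) (hξ : IsPrimitiveRoot ξ m) {q : L[X]}
    (hq : q.natDegree ≤ d) (h0 : q ≠ 0) : landenNum m d q q ≠ 0 := by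
  have hm' : 0 < m := Nat.pos_of_ne_zero (by rintro rfl; simp at hm)
  intro h
  have h1 := mul_cofactor_eq_expand hm hξ hq
  rw [h, map_zero, mul_cofactor_eq_prod hm' hξ hq, Finset.prod_eq_zero_iff] at h1
  obtain ⟨i, -, hi⟩ := h1
  refine h0 ?_
  ext k
  have h2 := congrArg (fun p => p.coeff k) hi
  simp only [comp_C_mul_X_coeff, coeff_zero] at h2
  rw [coeff_zero]
  exact (mul_eq_zero.mp h2).resolve_right
    (pow_ne_zero _ (pow_ne_zero _ (hξ.ne_zero hm'.ne')))

/-- By invariance the norm is one common denominator for all rotates; the numerators then sum by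
orthogonality of roots of unity. -/
lemma sum_div_root_of_unity {M : Type*} [Field M] (φ : L →+* M) (u : M) (hm : (m : L) ≠ 0)
    (hξ : IsPrimitiveRoot ξ m) (p : L[X]) {q : L[X]} (hq : q.natDegree ≤ d)
    (h0 : ∀ t, eval₂ φ (φ (ξ ^ t) * u) q ≠ 0) :
    ∑ t ∈ Finset.range m, eval₂ φ (φ (ξ ^ t) * u) p / eval₂ φ (φ (ξ ^ t) * u) q =
      m * (eval₂ φ (u ^ m) (landenNum m d p q) / eval₂ φ (u ^ m) (landenNum m d q q)) := by
  have hm' : 0 < m := Nat.pos_of_ne_zero (by rintro rfl; simp at hm)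
  have hcomp : ∀ (f : L[X]) (t : ℕ),
      eval₂ φ u (f.comp (C (ξ ^ t) * X)) = eval₂ φ (φ (ξ ^ t) * u) f := by
    intro f t
    rw [eval₂_comp, eval₂_mul, eval₂_C, eval₂_X]
  have hexp : ∀ f : L[X], eval₂ φ u (expand L m f) = eval₂ φ (u ^ m) f := by
    intro f
    rw [expand_eq_comp_X_pow, eval₂_comp, eval₂_pow, eval₂_X]
  set D := eval₂ φ (u ^ m) (landenNum m d q q) with hD
  have hqD : ∀ t, eval₂ φ (φ (ξ ^ t) * u) q * eval₂ φ (φ (ξ ^ t) * u) (cofactor m d q) = D := by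
    intro t
    rw [← eval₂_mul, ← hcomp, mul_cofactor_comp hm' hξ hq, mul_cofactor_eq_expand hm hξ hq, hexp]
  have hD0 : D ≠ 0 := by
    rw [hD, ← hexp, ← mul_cofactor_eq_expand hm hξ hq, mul_cofactor_eq_prod hm' hξ hq,
      ← coe_eval₂RingHom, map_prod, Finset.prod_ne_zero_iff]
    intro t _
    rw [coe_eval₂RingHom, hcomp]
    exact h0 t
  have hterm : ∀ t, eval₂ φ (φ (ξ ^ t) * u) p / eval₂ φ (φ (ξ ^ t) * u) q =
      eval₂ φ u ((p * cofactor m d q).comp (C (ξ ^ t) * X)) / D := by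
    intro t
    rw [hcomp, eval₂_mul, div_eq_div_iff (h0 t) hD0, ← hqD t]
    ring
  rw [Finset.sum_congr rfl fun t _ => hterm t, ← Finset.sum_div, ← eval₂_finsetSum,
    sum_comp_root_of_unity hm' hξ, eval₂_mul, eval₂_C, map_natCast, hexp, mul_div_assoc, landenNum]

end RootsOfUnity

/-! ### The Landen transform in coordinates -/

section Forms

open Polynomial

variable {K : Type} [Field K] {d m : ℕ}

lemma coeff_form (a : Fin (d + 1) → K) (i : Fin (d + 1)) : (form a).coeff (d - i) = a i := by
  rw [form, finsetSum_coeff, Finset.sum_eq_single i]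
  · simp
  · intro j _ hj
    rw [coeff_C_mul_X_pow, if_neg fun h => hj (Fin.ext (by omega))]
  · simp

lemma natDegree_form_le (a : Fin (d + 1) → K) : (form a).natDegree ≤ d :=
  natDegree_sum_le_of_forall_le _ _ fun _ _ =>
    (natDegree_C_mul_X_pow_le _ _).trans (Nat.sub_le _ _)

/-- This is the passage to `u = 1 / z`; the factor `x ^ d` cancels in quotients. -/
lemma eval₂_form {M : Type} [Field M] (f : K →+* M) {x : M} (hx : x ≠ 0) (a : Fin (d + 1) → K) :
    eval₂ f x (form a) = x ^ d * eval₂ f x⁻¹ (vecPoly a) := by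
  rw [form, vecPoly, eval₂_finsetSum, eval₂_finsetSum, Finset.mul_sum]
  refine Finset.sum_congr rfl fun i _ => ?_
  rw [eval₂_mul, eval₂_mul, eval₂_C, eval₂_C, eval₂_pow, eval₂_pow, eval₂_X, eval₂_X, inv_pow,
    mul_left_comm, ← div_eq_mul_inv, pow_sub₀ _ hx (Nat.lt_succ_iff.mp i.2), div_eq_mul_inv]

lemma form_injective : Function.Injective (form : (Fin (d + 1) → K) → K[X]) := by
  intro a b h
  funext i
  rw [← coeff_form a, h, coeff_form]

lemma form_zero : form (0 : Fin (d + 1) → K) = 0 := by simp [form]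

lemma vecPoly_ne_zero {a : Fin (d + 1) → K} (ha : form a ≠ 0) : vecPoly a ≠ 0 := by
  intro h
  refine ha ?_
  rw [← form_zero]
  congr 1
  funext i
  rw [← coeff_vecPoly a, h, coeff_zero, Pi.zero_apply]

lemma form_ne_zero {a : Fin (d + 1) → K} (ha : vecPoly a ≠ 0) : form a ≠ 0 := by
  intro h
  have : a = 0 := form_injective (h.trans form_zero.symm)
  exact ha (by simp [this, vecPoly])

lemma eval_div {M : Type} [Field M] (f : K →+* M) {x : M} (hx : ∀ g : K[X], g ≠ 0 → eval₂ f x g ≠ 0)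
    (p : K[X]) {q : K[X]} (hq : q ≠ 0) :
    (algebraMap K[X] (RatFunc K) p / algebraMap K[X] (RatFunc K) q).eval f x =
      eval₂ f x p / eval₂ f x q := by
  have h := (RatFunc.num_mul_eq_mul_denom_iff
    (x := algebraMap K[X] (RatFunc K) p / algebraMap K[X] (RatFunc K) q) (p := p) hq).mpr rfl
  have h1 := congrArg (eval₂ f x) h
  rw [eval₂_mul, eval₂_mul] at h1
  rw [RatFunc.eval, div_eq_div_iff (hx _ (RatFunc.denom_ne_zero _)) (hx _ hq), h1]

lemma eval_injective {M : Type} [Field M] (f : K →+* M) {x : M}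
    (hx : ∀ g : K[X], g ≠ 0 → eval₂ f x g ≠ 0) : Function.Injective (RatFunc.eval f x) := by
  intro φ ψ h
  rw [RatFunc.eval, RatFunc.eval, div_eq_div_iff (hx _ (RatFunc.denom_ne_zero _))
    (hx _ (RatFunc.denom_ne_zero _)), ← eval₂_mul, ← eval₂_mul] at h
  have h1 : φ.num * ψ.denom = ψ.num * φ.denom := by
    by_contra hne
    refine hx _ (sub_ne_zero.mpr hne) ?_
    rw [eval₂_sub, h, sub_self]
  rw [RatFunc.num_mul_eq_mul_denom_iff (RatFunc.denom_ne_zero _), RatFunc.num_div_denom] at h1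
  exact h1

lemma eval₂_algebraMap_ne_zero {L : Type} [Field L] (i : K →+* L) {g : L[X]} (hg : g.natDegree ≠ 0)
    (p : K[X]) (hp : p ≠ 0) : eval₂ (RatFunc.C.comp i) (algebraMap L[X] (RatFunc L) g) p ≠ 0 := by
  have hC : (algebraMap L[X] (RatFunc L)).comp C = RatFunc.C := by
    ext c
    simp
  rw [← eval₂_map, ← hC, ← hom_eval₂]
  refine (map_ne_zero_iff _ (RatFunc.algebraMap_injective L)).mpr ?_
  change (p.map i).comp g ≠ 0
  rw [Ne, comp_eq_zero_iff, not_or]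
  refine ⟨(Polynomial.map_ne_zero_iff i.injective).mpr hp, fun h => hg ?_⟩
  rw [h.2, natDegree_C]

/-- The coefficient vector of the numerator of the Landen transform. -/
noncomputable def landenVec (m : ℕ) (a b : Fin (d + 1) → K) (i : Fin (d + 1)) : K :=
  (landenNum m d (vecPoly a) (vecPoly b)).coeff i

lemma aeval_landenForm_eq_elim (hm : 0 < m) (a b : Fin (d + 1) → K)
    (j : Fin (d + 1) ⊕ Fin (d + 1)) :
    MvPolynomial.aeval (Sum.elim a b) (landenForm d m j) =
      Sum.elim (landenVec m a b) (landenVec m b b) j := by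
  rcases j with i | i
  · exact aeval_landenForm_inl hm _ i
  · exact aeval_landenForm_inr hm _ i

/-- The degree bound is checked over an algebraic closure, where a primitive root turns the cofactor
into a product of `m - 1` rotates. -/
lemma vecPoly_landenVec (hm : (m : K) ≠ 0) (a b : Fin (d + 1) → K) :
    vecPoly (landenVec m a b) = landenNum m d (vecPoly a) (vecPoly b) := by
  have hm' : 0 < m := Nat.pos_of_ne_zero (by rintro rfl; simp at hm)
  have : NeZero (m : AlgebraicClosure K) := ⟨by
    rw [← map_natCast (algebraMap K (AlgebraicClosure K))]
    exact (_root_.map_ne_zero _).mpr hm⟩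
  obtain ⟨ξ, hξ⟩ := HasEnoughRootsOfUnity.exists_primitiveRoot (AlgebraicClosure K) m
  refine vecPoly_coeff (natDegree_landenNum_le hm' (natDegree_vecPoly_le a) ?_)
  have h := natDegree_cofactor_le hm' hξ (d := d)
    (q := (vecPoly b).map (algebraMap K (AlgebraicClosure K)))
    (natDegree_map_le.trans (natDegree_vecPoly_le b))
  rwa [cofactor_map, natDegree_map] at h

lemma form_landenVec_ne_zero {L : Type} [Field L] (φ : K →+* L) (hm : (m : K) ≠ 0) {ξ : L} (hξ : IsPrimitiveRoot ξ m)
    {b : Fin (d + 1) → K} (hb : form b ≠ 0) : form (landenVec m b b) ≠ 0 := by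
  have hm' : 0 < m := Nat.pos_of_ne_zero (by rintro rfl; simp at hm)
  refine form_ne_zero ?_
  rw [vecPoly_landenVec hm]
  intro h
  refine landenNum_self_ne_zero (m := m) (d := d)
    (q := (vecPoly b).map φ) ?_ hξ
    (natDegree_map_le.trans (natDegree_vecPoly_le b))
    ((Polynomial.map_ne_zero_iff φ.injective).mpr (vecPoly_ne_zero hb)) ?_
  · rw [← map_natCast φ]
    exact (_root_.map_ne_zero _).mpr hm
  · rw [landenNum_map _ hm', h, Polynomial.map_zero]

lemma eval_ratFun_landenVec {L : Type} [Field L] (φ : K →+* L) (hm : (m : K) ≠ 0) {ζ : L}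
    (hζ : IsPrimitiveRoot ζ m)
    (a : Fin (d + 1) → K) {b : Fin (d + 1) → K} (hb : form b ≠ 0) :
    (ratFun (landenVec m a b) (landenVec m b b)).eval
        (RatFunc.C.comp φ) (RatFunc.X ^ m) =
      1 / ((m : RatFunc L) * RatFunc.X ^ 0) *
        ∑ t ∈ Finset.range m, RatFunc.C ((ζ ^ (0 * t))⁻¹) *
          (ratFun a b).eval (RatFunc.C.comp φ)
            (RatFunc.C (ζ ^ t) * RatFunc.X) := by
  have hm' : 0 < m := Nat.pos_of_ne_zero (by rintro rfl; simp at hm)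
  have hmL : (m : L) ≠ 0 := by
    rw [← map_natCast φ]
    exact (_root_.map_ne_zero _).mpr hm
  have hmM : (m : RatFunc L) ≠ 0 := by
    rw [← map_natCast RatFunc.C]
    exact (_root_.map_ne_zero _).mpr hmL
  set f := RatFunc.C.comp φ with hf
  have hζ0 : ∀ t, ζ ^ t ≠ 0 := fun t => pow_ne_zero t (hζ.ne_zero hm'.ne')
  have hx : ∀ t, ∀ g : K[X], g ≠ 0 → eval₂ f (RatFunc.C (ζ ^ t) * RatFunc.X) g ≠ 0 := by
    intro t g hg
    have := eval₂_algebraMap_ne_zero φ (g := C (ζ ^ t) * X)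
      (by rw [natDegree_C_mul_X _ (hζ0 t)]; exact one_ne_zero) g hg
    rwa [map_mul, RatFunc.algebraMap_C, RatFunc.algebraMap_X] at this
  have hxm : ∀ g : K[X], g ≠ 0 → eval₂ f (RatFunc.X ^ m) g ≠ 0 := by
    intro g hg
    have := eval₂_algebraMap_ne_zero φ (g := X ^ m)
      (by rw [natDegree_X_pow]; exact hm'.ne') g hg
    rwa [map_pow, RatFunc.algebraMap_X] at this
  have hX0 : (RatFunc.X : RatFunc L) ≠ 0 := RatFunc.X_ne_zero
  have hx0 : ∀ t, RatFunc.C (ζ ^ t) * RatFunc.X ≠ 0 := fun t =>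
    mul_ne_zero ((_root_.map_ne_zero _).mpr (hζ0 t)) hX0
  have hinv : ∀ t, (RatFunc.C (ζ ^ t) * RatFunc.X)⁻¹ = RatFunc.C (ζ⁻¹ ^ t) * RatFunc.X⁻¹ := by
    intro t
    rw [mul_inv, inv_pow, map_inv₀]
  have hterm : ∀ t, (ratFun a b).eval f (RatFunc.C (ζ ^ t) * RatFunc.X) =
      eval₂ RatFunc.C (RatFunc.C (ζ⁻¹ ^ t) * RatFunc.X⁻¹) ((vecPoly a).map φ) /
      eval₂ RatFunc.C (RatFunc.C (ζ⁻¹ ^ t) * RatFunc.X⁻¹) ((vecPoly b).map φ) := by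
    intro t
    rw [ratFun, eval_div f (hx t) _ hb, eval₂_form f (hx0 t), eval₂_form f (hx0 t),
      mul_div_mul_left _ _ (pow_ne_zero _ (hx0 t)), hinv, eval₂_map, eval₂_map]
  have hq0 : ∀ t, eval₂ RatFunc.C (RatFunc.C (ζ⁻¹ ^ t) * RatFunc.X⁻¹)
      ((vecPoly b).map φ) ≠ 0 := by
    intro t h
    refine hx t _ hb ?_
    rw [eval₂_form f (hx0 t), hinv, hf, ← eval₂_map, h, mul_zero]
  -- Inverting the variable inverts the rotation, hence `ζ⁻¹`.
  have hsum := sum_div_root_of_unity (RatFunc.C (K := L)) RatFunc.X⁻¹ hmL hζ.inv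
    ((vecPoly a).map φ) (d := d)
    (natDegree_map_le.trans (natDegree_vecPoly_le b)) hq0
  simp only [zero_mul, pow_zero, inv_one, map_one, one_mul, mul_one]
  rw [Finset.sum_congr rfl fun t _ => hterm t, hsum, ratFun,
    eval_div f hxm _ (form_landenVec_ne_zero φ hm hζ hb), eval₂_form f (pow_ne_zero m hX0),
    eval₂_form f (pow_ne_zero m hX0), mul_div_mul_left _ _ (pow_ne_zero _ (pow_ne_zero m hX0)),
    vecPoly_landenVec hm, vecPoly_landenVec hm, landenNum_map _ hm', landenNum_map _ hm',
    eval₂_map, eval₂_map, inv_pow, one_div, inv_mul_cancel_left₀ hmM]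

lemma isLandenTransform_ratFun (hm : (m : K) ≠ 0) (a : Fin (d + 1) → K) {b : Fin (d + 1) → K}
    (hb : form b ≠ 0) :
    IsLandenTransform m 0 (ratFun a b) (ratFun (landenVec m a b) (landenVec m b b)) := by
  have : NeZero (m : AlgebraicClosure K) := ⟨by
    rw [← map_natCast (algebraMap K (AlgebraicClosure K))]
    exact (_root_.map_ne_zero _).mpr hm⟩
  obtain ⟨ζ, hζ⟩ := HasEnoughRootsOfUnity.exists_primitiveRoot (AlgebraicClosure K) m
  exact ⟨ζ, hζ, eval_ratFun_landenVec _ hm hζ a hb⟩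

/-- A rational function is determined by its value at the transcendental element `w ^ m`, and the
computed transform gives that value for any primitive root. -/
lemma IsLandenTransform.eq_ratFun {ψ : RatFunc K} (hm : (m : K) ≠ 0) {a b : Fin (d + 1) → K}
    (hb : form b ≠ 0) (h : IsLandenTransform m 0 (ratFun a b) ψ) :
    ψ = ratFun (landenVec m a b) (landenVec m b b) ∧ form (landenVec m b b) ≠ 0 := by
  have hm' : 0 < m := Nat.pos_of_ne_zero (by rintro rfl; simp at hm)
  obtain ⟨ζ, hζ, h⟩ := h
  refine ⟨?_, form_landenVec_ne_zero (algebraMap K (AlgebraicClosure K)) hm hζ hb⟩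
  refine eval_injective (RatFunc.C.comp (algebraMap K (AlgebraicClosure K)))
    (x := RatFunc.X ^ m) (fun g hg => ?_) (h.trans (eval_ratFun_landenVec _ hm hζ a hb).symm)
  have := eval₂_algebraMap_ne_zero (algebraMap K (AlgebraicClosure K)) (g := X ^ m)
    (by rw [natDegree_X_pow]; exact hm'.ne') g hg
  rwa [map_pow, RatFunc.algebraMap_X] at this

lemma form_ne_zero_of_ratDegree (hd : 1 ≤ d) {a b : Fin (d + 1) → K}
    (h : ratDegree (ratFun a b) = d) : form b ≠ 0 := by
  intro hb
  -- Division by zero yields the zero function, of degree `0`, which contradicts `1 ≤ d`.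
  rw [ratFun, hb, map_zero, div_zero, ratDegree, RatFunc.num_zero, RatFunc.denom_zero] at h
  simp at h
  omega

/-- Numerator and denominator have degree at most `d`, so a reduced fraction of degree `d` leaves
room only for a constant common factor. -/
lemma exists_form_eq_C_mul {a b : Fin (d + 1) → K} (hb : form b ≠ 0)
    (h : ratDegree (ratFun a b) = d) :
    ∃ c, c ≠ 0 ∧ form a = C c * (ratFun a b).num ∧ form b = C c * (ratFun a b).denom := by
  set φ := ratFun a b with hφ
  have h1 : φ.num * form b = form a * φ.denom := (RatFunc.num_mul_eq_mul_denom_iff hb).mpr hφ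
  obtain ⟨g, hg⟩ := RatFunc.denom_div_dvd (form a) (form b)
  have hg' : form b = φ.denom * g := hg
  have hg0 : g ≠ 0 := by
    rintro rfl
    exact hb (by rw [hg', mul_zero])
  have h2 : form a = φ.num * g := by
    refine mul_right_cancel₀ (RatFunc.denom_ne_zero φ) ?_
    rw [← h1, hg']
    ring
  have hdeg : g.natDegree = 0 := by
    have hda := natDegree_form_le a
    have hdb := natDegree_form_le b
    rw [hg', natDegree_mul (RatFunc.denom_ne_zero φ) hg0] at hdb
    by_cases hn : φ.num = 0
    · rw [ratDegree, hn, natDegree_zero, Nat.zero_max] at h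
      omega
    · rw [h2, natDegree_mul hn hg0] at hda
      rw [ratDegree] at h
      omega
  rw [eq_C_of_natDegree_eq_zero hdeg] at h2 hg' hg0
  exact ⟨g.coeff 0, fun h => hg0 (by rw [h, C_0]), by rw [h2, mul_comm], by rw [hg', mul_comm]⟩

lemma exists_eq_mul_of_ratFun_eq (hd : 1 ≤ d) {a b a' b' : Fin (d + 1) → K} (hb : form b ≠ 0)
    (h : ratDegree (ratFun a' b') = d) (heq : ratFun a' b' = ratFun a b) :
    ∃ c, c ≠ 0 ∧ ∀ j, Sum.elim a b j = c * Sum.elim a' b' j := by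
  obtain ⟨c, hc, h1, h2⟩ := exists_form_eq_C_mul (form_ne_zero_of_ratDegree hd h) h
  obtain ⟨c', hc', h3, h4⟩ := exists_form_eq_C_mul hb (heq ▸ h)
  rw [heq] at h1 h2
  refine ⟨c' / c, div_ne_zero hc' hc, ?_⟩
  have key : ∀ (x y : Fin (d + 1) → K) (g : K[X]), form x = C c' * g → form y = C c * g →
      ∀ i, x i = c' / c * y i := by
    intro x y g hx hy i
    rw [← coeff_form x, ← coeff_form y, hx, hy, coeff_C_mul, coeff_C_mul, ← mul_assoc,
      div_mul_cancel₀ _ hc]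
  rintro (i | i)
  · exact key _ _ _ h3 h1 i
  · exact key _ _ _ h4 h2 i

end Forms

/-! ### The generic rational function has degree `d` -/

section GenericDegree

open Polynomial

variable {A B : Type*} [CommRing A] [CommRing B] {d : ℕ}

/-- The polynomial with a given coefficient vector, in order of decreasing degree. -/
noncomputable def ringForm (a : Fin (d + 1) → A) : A[X] := ∑ i, C (a i) * X ^ (d - (i : ℕ))

lemma ringForm_map (φ : A →+* B) (a : Fin (d + 1) → A) :
    (ringForm a).map φ = ringForm (φ ∘ a) := by
  simp [ringForm, Polynomial.map_sum]

lemma ringForm_single (i : Fin (d + 1)) : ringForm (Pi.single i (1 : A)) = X ^ (d - (i : ℕ)) := by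
  rw [ringForm, Finset.sum_eq_single i]
  · simp
  · intro j _ hj
    simp [hj]
  · simp

/-- Specializing to `1 / z ^ d` gives the resultant `± 1`. -/
lemma resultant_ringForm_chartVec_ne_zero :
    resultant (ringForm (chartVec d ∘ Sum.inl)) (ringForm (chartVec d ∘ Sum.inr)) d d ≠ 0 := by
  intro h
  set ψ : MvPolynomial (Fin (d + 1) ⊕ Fin d) ℤ →+* ℤ :=
    MvPolynomial.eval (Sum.elim (Pi.single (Fin.last d) 1) 0) with hψ
  have h1 := congrArg ψ h
  have hl : ψ ∘ chartVec d ∘ Sum.inl = Pi.single (Fin.last d) 1 := by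
    funext i
    exact MvPolynomial.eval_X _
  have hr : ψ ∘ chartVec d ∘ Sum.inr = Pi.single 0 1 := by
    funext i
    refine Fin.cases ?_ (fun i => ?_) i
    · simp [hψ, chartVec]
    · simp [hψ, chartVec]
  rw [← resultant_map_map, ringForm_map, ringForm_map, hl, hr, ringForm_single, ringForm_single,
    Fin.val_last, Nat.sub_self, Fin.val_zero, Nat.sub_zero, pow_zero,
    resultant_X_pow_right _ _ _ (by simp), coeff_one_zero, one_pow, mul_one, map_zero] at h1
  exact pow_ne_zero _ (by norm_num) h1

lemma ratDegree_ratFun_comp_chartVec (hd : 1 ≤ d) {K : Type} [Field K]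
    (φ : MvPolynomial (Fin (d + 1) ⊕ Fin d) ℤ →+* K) (hφ : Function.Injective φ) :
    ratDegree (ratFun (φ ∘ chartVec d ∘ Sum.inl) (φ ∘ chartVec d ∘ Sum.inr)) = d := by
  set p := form (φ ∘ chartVec d ∘ Sum.inl) with hp
  set q := form (φ ∘ chartVec d ∘ Sum.inr) with hq
  have hpd : p.natDegree ≤ d := natDegree_form_le _
  have hqd : q.natDegree ≤ d := natDegree_form_le _
  have hcop : IsCoprime p q := by
    obtain ⟨f, g, -, -, hfg⟩ := exists_mul_add_mul_eq_C_resultant p q hpd hqd (by omega)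
    have h1 : resultant p q d d = φ (resultant (ringForm (chartVec d ∘ Sum.inl))
        (ringForm (chartVec d ∘ Sum.inr)) d d) := by
      rw [← resultant_map_map, ringForm_map, ringForm_map]
      rfl
    have h2 : resultant p q d d ≠ 0 := by
      rw [h1]
      exact (map_ne_zero_iff φ hφ).mpr resultant_ringForm_chartVec_ne_zero
    refine ⟨C (resultant p q d d)⁻¹ * f, C (resultant p q d d)⁻¹ * g, ?_⟩
    have h3 : C (resultant p q d d)⁻¹ * (p * f + q * g) = 1 := by
      rw [hfg, ← C_mul, inv_mul_cancel₀ h2, C_1]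
    rw [← h3]
    ring
  have hqc : q.coeff d = 1 := by
    have := coeff_form (φ ∘ chartVec d ∘ Sum.inr) 0
    rw [Fin.val_zero, Nat.sub_zero] at this
    exact this.trans (map_one φ)
  have hq0 : q ≠ 0 := by
    intro h
    rw [h, coeff_zero] at hqc
    exact zero_ne_one hqc
  have hdeg : q.natDegree = d :=
    le_antisymm hqd (le_natDegree_of_ne_zero (by rw [hqc]; exact one_ne_zero))
  change ratDegree (algebraMap K[X] (RatFunc K) p / algebraMap K[X] (RatFunc K) q) = d
  set ψ := algebraMap K[X] (RatFunc K) p / algebraMap K[X] (RatFunc K) q with hψ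
  have h1 : ψ.num * q = p * ψ.denom := (RatFunc.num_mul_eq_mul_denom_iff hq0).mpr hψ
  have h2 : q ∣ ψ.denom := hcop.symm.dvd_of_dvd_mul_left ⟨ψ.num, by rw [← h1, mul_comm]⟩
  have h3 : ψ.denom.natDegree = d := by
    refine le_antisymm ?_ (hdeg ▸ natDegree_le_of_dvd h2 (RatFunc.denom_ne_zero ψ))
    exact (natDegree_le_of_dvd (RatFunc.denom_div_dvd p q) hq0).trans hqd
  have h4 : ψ.num.natDegree ≤ d := by
    by_cases hp0 : p = 0
    · have : ψ.num = 0 := by rw [hψ, hp0, map_zero, zero_div, RatFunc.num_zero]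
      rw [this, natDegree_zero]
      exact Nat.zero_le d
    · exact (natDegree_le_of_dvd (RatFunc.num_div_dvd p hq0) hp0).trans hpd
  rw [ratDegree, h3]
  exact max_eq_right h4

end GenericDegree

/-! ### Existence, uniqueness, commutation and the affine loci -/

section LandenMapProperties

attribute [local instance] MvPolynomial.gradedAlgebra

variable {d m n : ℕ}

lemma span_range_chartVec : Ideal.span (Set.range (chartVec d)) = ⊤ :=
  span_eq_top_of_one _ (Sum.inr 0) rfl

lemma Sends.precomp {X Y T U : Scheme.{0}} {f : X ⤏ Y} {x : T ⟶ X} {y : T ⟶ Y} (h : Sends f x y)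
    (g : U ⟶ T) : Sends f (g ≫ x) (g ≫ y) := by
  obtain ⟨f', hf, x', rfl, rfl⟩ := h
  exact ⟨f', hf, g ≫ x', Category.assoc _ _ _, Category.assoc _ _ _⟩

lemma sends_landenMap_of_field (hm : 0 < m) {K : Type} [Field K]
    (w : Fin (d + 1) ⊕ Fin (d + 1) → K) (hw : Ideal.span (Set.range w) = ⊤)
    (hFw : Ideal.span (Set.range fun l => MvPolynomial.aeval w (landenForm d m l)) = ⊤) :
    Sends (landenMap d m hm) (point w hw)
      (point (fun l => MvPolynomial.aeval w (landenForm d m l)) hFw) :=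
  sends_formMap_of_field chartVec_inr_zero chartVec_chartIdx eq_or_exists_chartIdx hm
    (isHomogeneous_landenForm hm) (landenForm_inr_zero_ne_zero hm) w hw hFw

lemma isLandenMap_landenMap (hd : 1 ≤ d) (hm : 0 < m) : IsLandenMap d m 0 (landenMap d m hm) := by
  intro K _ hmK a b a' b' hdeg htr hdeg' h h'
  obtain ⟨heq, hFb⟩ := htr.eq_ratFun hmK (form_ne_zero_of_ratDegree hd hdeg)
  obtain ⟨c, hc, hcj⟩ := exists_eq_mul_of_ratFun_eq hd hFb hdeg' heq
  obtain ⟨j, hj⟩ := exists_ne_zero_of_span_range h'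
  have hF : ∀ l, MvPolynomial.aeval (Sum.elim a b) (landenForm d m l) = c * Sum.elim a' b' l :=
    fun l => (aeval_landenForm_eq_elim hm a b l).trans (hcj l)
  have hFj : MvPolynomial.aeval (Sum.elim a b) (landenForm d m j) ≠ 0 := by
    rw [hF]
    exact mul_ne_zero hc hj
  rw [point_smul c hF h' (span_range_eq_top_of_ne_zero hFj) hFj.isUnit]
  exact sends_landenMap_of_field hm _ h _

lemma aeval_chartForm_injective (hm : 0 < m) :
    Function.Injective (MvPolynomial.aeval (R := ℤ) (chartForm (chartVec d) (chartIdx d) m)) := by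
  refine (injective_iff_map_eq_zero _).mpr fun p hp => ?_
  set s : Spec (.of ℤ) := (⟨⊥, Ideal.isPrime_bot⟩ : PrimeSpectrum ℤ)
  have h1 := congrArg (reduction _ s) hp
  rw [reduction_aeval, map_zero] at h1
  have h2 := (map_eq_zero_iff _ (independentOnFibres_chartForm_chartVec hm s)).mp h1
  refine MvPolynomial.map_injective (Ideal.Quotient.mk s.asIdeal) ?_ (h2.trans (map_zero _).symm)
  rw [RingHom.injective_iff_ker_eq_bot, Ideal.mk_ker]

lemma eq_landenMap (hd : 1 ≤ d) (hm : 0 < m) {S : PP d ⤏ PP d} (hS : IsLandenMap d m 0 S) :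
    S = landenMap d m hm := by
  obtain ⟨K, _, φ, hφ⟩ : ∃ (K : Type) (_ : Field K)
      (φ : MvPolynomial (Fin (d + 1) ⊕ Fin d) ℤ →+* K), Function.Injective φ :=
    ⟨_, _, algebraMap _ (FractionRing (MvPolynomial (Fin (d + 1) ⊕ Fin d) ℤ)),
      IsFractionRing.injective _ _⟩
  have hmK : (m : K) ≠ 0 := by
    rw [← map_natCast φ]
    exact (map_ne_zero_iff φ hφ).mpr (Nat.cast_ne_zero.mpr hm.ne')
  set a := φ ∘ chartVec d ∘ Sum.inl with ha
  set b := φ ∘ chartVec d ∘ Sum.inr with hb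
  have hab : Sum.elim a b = φ ∘ chartVec d := Sum.elim_comp_inl_inr (φ ∘ chartVec d)
  -- The image of the generic point is the generic vector under another injective homomorphism, so
  -- the transform has degree `d` for the same reason as the original function.
  set φ' := φ.comp (MvPolynomial.aeval (R := ℤ) (chartForm (chartVec d) (chartIdx d) m)).toRingHom
    with hφ'
  have hφi : Function.Injective φ' := hφ.comp (aeval_chartForm_injective hm)
  have hF : ∀ j, Sum.elim (landenVec m a b) (landenVec m b b) j = φ' (chartVec d j) := by
    intro j
    rw [← aeval_landenForm_eq_elim hm, hab, ← ringHom_aeval]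
    exact congrArg φ (aeval_chartForm_chartVec hm j).symm
  have ha' : landenVec m a b = φ' ∘ chartVec d ∘ Sum.inl := funext fun i => hF (Sum.inl i)
  have hb' : landenVec m b b = φ' ∘ chartVec d ∘ Sum.inr := funext fun i => hF (Sum.inr i)
  have hdeg : ratDegree (ratFun a b) = d := ratDegree_ratFun_comp_chartVec hd φ hφ
  have hdeg' : ratDegree (ratFun (landenVec m a b) (landenVec m b b)) = d := by
    rw [ha', hb']
    exact ratDegree_ratFun_comp_chartVec hd φ' hφi
  have htr := isLandenTransform_ratFun hmK a (form_ne_zero_of_ratDegree hd hdeg)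
  have hs : Ideal.span (Set.range (Sum.elim a b)) = ⊤ := by
    rw [hab]
    exact span_range_comp φ _ span_range_chartVec
  have hs' : Ideal.span (Set.range (Sum.elim (landenVec m a b) (landenVec m b b))) = ⊤ := by
    rw [funext hF]
    exact span_range_comp φ' _ span_range_chartVec
  have : IsDominant (point (Sum.elim a b) hs) := by
    have := isDominant_point_comp chartVec_inr_zero chartVec_chartIdx eq_or_exists_chartIdx φ hφ
      (span_range_comp φ _ span_range_chartVec)
    convert this
  exact eq_of_sends (point (Sum.elim a b) hs)
    (hS K hmK a b _ _ hdeg htr hdeg' hs hs')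
    (isLandenMap_landenMap hd hm K hmK a b _ _ hdeg htr hdeg' hs hs')

lemma sends_landenMap_chart (hm : 0 < m) : Sends (landenMap d m hm) (chart d)
    (polyMap (chartForm (chartVec d) (chartIdx d) m) ≫ chart d) :=
  sends_landenMap chartVec_inr_zero (aeval_chartForm_chartVec hm) hm span_range_chartVec

lemma sends_landenMap_slice (hm : 0 < m) : Sends (landenMap d m hm) (slice d)
    (polyMap (chartForm (sliceVec d) (sliceIdx d) m) ≫ slice d) :=
  sends_landenMap sliceVec_inr_zero (aeval_chartForm_sliceVec hm) hm _

lemma dominantOnFibres_landenMap (hm : 0 < m) : DominantOnFibres (landenMap d m hm) :=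
  dominantOnFibres_of_sends (independentOnFibres_chartForm_chartVec hm) (chart d)
    (sends_landenMap_chart hm) fun s => fibre_subset_closure_point chartVec_inr_zero
      chartVec_chartIdx eq_or_exists_chartIdx span_range_chartVec s

lemma hasAlgebraicDegree_landenMap (hd : 1 ≤ d) (hm : 0 < m) :
    HasAlgebraicDegree (landenMap d m hm) m :=
  ⟨landenForm d m, isHomogeneous_landenForm hm, fun _ hu => isUnit_of_forall_dvd_landenForm hd hm hu,
    fun _ _ v hv hF => sends_landenMap_of_field hm v hv hF⟩

lemma isDominant_chart : IsDominant (chart d) :=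
  isDominant_point chartVec_inr_zero chartVec_chartIdx eq_or_exists_chartIdx span_range_chartVec

lemma ratCommute_landenMap (hm : 0 < m) (hn : 0 < n) :
    RatCommute (landenMap d m hm) (landenMap d n hn) := by
  have h1 := (dominantOnFibres_landenMap (d := d) hm).isDominant
  have h2 := (dominantOnFibres_landenMap (d := d) hn).isDominant
  have := isDominant_chart (d := d)
  refine ⟨h1, h2, eq_of_sends (chart d)
    ((sends_landenMap_chart hm).comp ((sends_landenMap_chart hn).precomp _)) ?_⟩
  have h3 := (sends_landenMap_chart (d := d) hn).comp ((sends_landenMap_chart hm).precomp _)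
  have h4 := polyMap_chartForm_comm (j := chartIdx d) chartVec_inr_zero
    (fun m hm s => aeval_chartForm_chartVec hm s) hm hn
  rwa [← Category.assoc, ← h4, Category.assoc] at h3

lemma isOpenImmersion_chart : IsOpenImmersion (chart d) ∧
    Set.range (chart d) = {x | x ∈ coordOpen (Sum.inr 0)} :=
  isOpenImmersion_point chartVec_inr_zero chartVec_chartIdx eq_or_exists_chartIdx

/-- The restriction of functions from the chart to the slice. -/
noncomputable def sliceHom (d : ℕ) :
    MvPolynomial (Fin (d + 1) ⊕ Fin d) ℤ →+* MvPolynomial (Fin d ⊕ Fin d) ℤ :=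
  (MvPolynomial.aeval (sliceVec d ∘ chartIdx d)).toRingHom

lemma sliceHom_X (t : Fin (d + 1) ⊕ Fin d) :
    sliceHom d (MvPolynomial.X t) = sliceVec d (chartIdx d t) := MvPolynomial.aeval_X _ _

lemma sliceHom_chartVec (s : Fin (d + 1) ⊕ Fin (d + 1)) :
    sliceHom d (chartVec d s) = sliceVec d s := by
  rcases eq_or_exists_chartIdx s with rfl | ⟨t, rfl⟩
  · rw [chartVec_inr_zero, map_one, sliceVec_inr_zero]
  · rw [chartVec_chartIdx, sliceHom_X]

lemma slice_eq : Spec.map (CommRingCat.ofHom (sliceHom d)) ≫ chart d = slice d := by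
  have h := Spec_map_point (sliceHom d) (chartVec d) span_range_chartVec
    (f := MvPolynomial.X (Sum.inr 0))
    (by rw [MvPolynomial.aeval_X, chartVec_inr_zero]; exact isUnit_one) one_pos
    (MvPolynomial.isHomogeneous_X ℤ _)
  refine h.trans ?_
  rw [slice]
  congr 1
  exact funext sliceHom_chartVec

/-- The section of `sliceHom` that sends variables to variables. -/
noncomputable def sliceSection (d : ℕ) :
    MvPolynomial (Fin d ⊕ Fin d) ℤ →+* MvPolynomial (Fin (d + 1) ⊕ Fin d) ℤ :=
  (MvPolynomial.rename (Sum.map Fin.succ id)).toRingHom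

lemma sliceSection_X (t : Fin d ⊕ Fin d) :
    sliceSection d (MvPolynomial.X t) = MvPolynomial.X (Sum.map Fin.succ id t) :=
  MvPolynomial.rename_X _ _

lemma sliceHom_sliceSection (p : MvPolynomial (Fin d ⊕ Fin d) ℤ) :
    sliceHom d (sliceSection d p) = p := by
  refine RingHom.congr_fun (f := (sliceHom d).comp (sliceSection d)) (g := RingHom.id _)
    (MvPolynomial.ringHom_ext (fun r => by simp) fun t => ?_) p
  rw [RingHom.comp_apply, sliceSection_X, sliceHom_X, RingHom.id_apply, ← sliceVec_sliceIdx]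
  rcases t with i | i <;> rfl

/-- Restricting to the slice and lifting back changes only the variable `a₀`, which is zero modulo
`I`. -/
lemma ker_sliceHom_le {I : Ideal (MvPolynomial (Fin (d + 1) ⊕ Fin d) ℤ)}
    (hI : MvPolynomial.X (Sum.inl 0) ∈ I) : RingHom.ker (sliceHom d) ≤ I := by
  intro p hp
  have h : (Ideal.Quotient.mk I).comp ((sliceSection d).comp (sliceHom d)) =
      Ideal.Quotient.mk I := by
    refine MvPolynomial.ringHom_ext (fun r => by simp) fun t => ?_
    rw [RingHom.comp_apply, RingHom.comp_apply, sliceHom_X]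
    rcases t with i | i
    · refine Fin.cases ?_ (fun i => ?_) i
      · rw [Ideal.Quotient.eq_zero_iff_mem.mpr hI]
        exact (congrArg _ (map_zero _)).trans (map_zero _)
      · exact congrArg _ (sliceSection_X (Sum.inl i))
    · exact congrArg _ (sliceSection_X (Sum.inr i))
  have h1 := RingHom.congr_fun h p
  rw [RingHom.comp_apply, RingHom.comp_apply, RingHom.mem_ker.mp hp, map_zero, map_zero] at h1
  exact Ideal.Quotient.eq_zero_iff_mem.mp h1.symm

lemma sliceHom_surjective : Function.Surjective (sliceHom d) :=
  fun p => ⟨_, sliceHom_sliceSection p⟩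

lemma isImmersion_slice : IsImmersion (slice d) := by
  have := isOpenImmersion_chart (d := d).1
  have := IsClosedImmersion.spec_of_surjective (CommRingCat.ofHom (sliceHom d)) sliceHom_surjective
  rw [← slice_eq]
  infer_instance

lemma range_slice : Set.range (slice d) =
    {x | x ∉ coordOpen (Sum.inl 0) ∧ x ∈ coordOpen (Sum.inr 0)} := by
  have hmem : ∀ (A : Type) [CommRing A] (v : Fin (d + 1) ⊕ Fin (d + 1) → A)
      (hv : Ideal.span (Set.range v) = ⊤) (i : Fin (d + 1) ⊕ Fin (d + 1)) (y : Spec (.of A)),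
      point v hv y ∈ coordOpen i ↔ v i ∉ y.asIdeal := by
    intro A _ v hv i y
    have h := point_mem_formOpen v hv (MvPolynomial.isHomogeneous_X ℤ i) one_pos y
    rwa [MvPolynomial.aeval_X] at h
  ext x
  constructor
  · rintro ⟨y, rfl⟩
    refine ⟨fun h => ?_, ?_⟩
    · exact (hmem _ (sliceVec d) (span_eq_top_of_one _ (Sum.inr 0) rfl) (Sum.inl 0) y).mp h
        y.asIdeal.zero_mem
    · exact (hmem _ (sliceVec d) (span_eq_top_of_one _ (Sum.inr 0) rfl) (Sum.inr 0) y).mpr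
        fun h => y.isPrime.ne_top ((Ideal.eq_top_iff_one _).mpr h)
  · rintro ⟨h1, h2⟩
    obtain ⟨y, rfl⟩ : x ∈ Set.range (chart d) := isOpenImmersion_chart.2 ▸ h2
    have h3 : MvPolynomial.X (Sum.inl 0) ∈ y.asIdeal := by
      by_contra h
      exact h1 ((hmem _ (chartVec d) span_range_chartVec (Sum.inl 0) y).mpr h)
    have h4 : y ∈ Set.range (PrimeSpectrum.comap (sliceHom d)) := by
      rw [_root_.range_comap_of_surjective _ _ sliceHom_surjective]
      exact ker_sliceHom_le h3
    obtain ⟨z, hz⟩ := h4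
    have h5 : slice d z = chart d (Spec.map (CommRingCat.ofHom (sliceHom d)) z) := by
      rw [← slice_eq]
      rfl
    exact ⟨z, h5.trans (congrArg (chart d) hz)⟩

end LandenMapProperties

end Landen

theorem corollary4 (d : ℕ) (hd : 1 ≤ d) :
    ∃ R : ℕ → (Landen.PP d ⤏ Landen.PP d),
      -- `R m` is the unique rational map induced by the `(m, 0)`-Landen transform
      (∀ m, 1 ≤ m → Landen.IsLandenMap d m 0 (R m) ∧
        ∀ S : Landen.PP d ⤏ Landen.PP d, Landen.IsLandenMap d m 0 S → S = R m) ∧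
      -- the maps are dominant, of algebraic degree `m`, and commute
      (∀ m, 1 ≤ m → (R m).IsDominant ∧ Landen.DominantOnFibres (R m) ∧
        Landen.HasAlgebraicDegree (R m) m) ∧
      (∀ m n, 1 ≤ m → 1 ≤ n → Landen.RatCommute (R m) (R n)) ∧
      -- the open subscheme `b₀ ≠ 0` is an affine space, and the maps induce commuting dominant
      -- polynomial endomorphisms of it
      (IsOpenImmersion (Landen.chart d) ∧
        Set.range (Landen.chart d) = {x | x ∈ Landen.coordOpen (Sum.inr 0)}) ∧
      (∃ e : ℕ → (Fin (d + 1) ⊕ Fin d) → MvPolynomial (Fin (d + 1) ⊕ Fin d) ℤ,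
        (∀ m, 1 ≤ m →
          Landen.Sends (R m) (Landen.chart d) (Landen.polyMap (e m) ≫ Landen.chart d) ∧
          IsDominant (Landen.polyMap (e m)) ∧
          Landen.DominantOnFibres (Landen.polyMap (e m)).toRationalMap) ∧
        ∀ m n, 1 ≤ m → 1 ≤ n →
          Landen.polyMap (e m) ≫ Landen.polyMap (e n) =
            Landen.polyMap (e n) ≫ Landen.polyMap (e m)) ∧
      -- the same for the locus `a₀ = 0`, `b₀ ≠ 0`
      (IsImmersion (Landen.slice d) ∧
        Set.range (Landen.slice d) =
          {x | x ∉ Landen.coordOpen (Sum.inl 0) ∧ x ∈ Landen.coordOpen (Sum.inr 0)}) ∧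
      (∃ e : ℕ → (Fin d ⊕ Fin d) → MvPolynomial (Fin d ⊕ Fin d) ℤ,
        (∀ m, 1 ≤ m →
          Landen.Sends (R m) (Landen.slice d) (Landen.polyMap (e m) ≫ Landen.slice d) ∧
          IsDominant (Landen.polyMap (e m)) ∧
          Landen.DominantOnFibres (Landen.polyMap (e m)).toRationalMap) ∧
        ∀ m n, 1 ≤ m → 1 ≤ n →
          Landen.polyMap (e m) ≫ Landen.polyMap (e n) =
            Landen.polyMap (e n) ≫ Landen.polyMap (e m)) := by
  have hR : ∃ R : ℕ → (Landen.PP d ⤏ Landen.PP d), ∀ m (hm : 1 ≤ m),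
      R m = Landen.landenMap d m hm :=
    -- The identity is a filler for `m = 0`, about which nothing is claimed.
    ⟨fun m => if hm : 1 ≤ m then Landen.landenMap d m hm else Scheme.Hom.toRationalMap (𝟙 (Landen.PP d)),
      fun m hm => dif_pos hm⟩
  obtain ⟨R, hR⟩ := hR
  refine ⟨R, fun m hm => ?_, fun m hm => ?_, fun m n hm hn => ?_, Landen.isOpenImmersion_chart,
    ⟨fun m => Landen.chartForm (Landen.chartVec d) (Landen.chartIdx d) m, fun m hm => ?_,
      fun m n hm hn => ?_⟩, ⟨Landen.isImmersion_slice, Landen.range_slice⟩,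
    ⟨fun m => Landen.chartForm (Landen.sliceVec d) (Landen.sliceIdx d) m, fun m hm => ?_,
      fun m n hm hn => ?_⟩⟩
  · rw [hR m hm]
    exact ⟨Landen.isLandenMap_landenMap hd hm, fun S hS => Landen.eq_landenMap hd hm hS⟩
  · rw [hR m hm]
    exact ⟨(Landen.dominantOnFibres_landenMap hm).isDominant, Landen.dominantOnFibres_landenMap hm,
      Landen.hasAlgebraicDegree_landenMap hd hm⟩
  · rw [hR m hm, hR n hn]
    exact Landen.ratCommute_landenMap hm hn
  · have he := Landen.independentOnFibres_chartForm_chartVec (d := d) hm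
    rw [hR m hm]
    exact ⟨Landen.sends_landenMap_chart hm, Landen.isDominant_polyMap he,
      Landen.dominantOnFibres_polyMap he⟩
  · exact Landen.polyMap_chartForm_comm Landen.chartVec_inr_zero
      (fun m hm s => Landen.aeval_chartForm_chartVec hm s) hm hn
  · have he := Landen.independentOnFibres_chartForm_sliceVec (d := d) hm
    rw [hR m hm]
    exact ⟨Landen.sends_landenMap_slice hm, Landen.isDominant_polyMap he,
      Landen.dominantOnFibres_polyMap he⟩
  · exact Landen.polyMap_chartForm_comm Landen.sliceVec_inr_zero
      (fun m hm s => Landen.aeval_chartForm_sliceVec hm s) hm hn
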